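/- A cube complex is a space $X$ obtained by gluing standard cubes $[-1,1]^n$ of bounded dimension by isometries between faces (open cubes are embedded, and $X$ has the quotient topology). It is non-positively curved (NPC) if the link of every vertex is a flag simplicial complex. Oriented edges are parallel if they are equivalent under the equivalence relation generated by being opposite, equally oriented edges of a square. The hyperplane $H$ dual to an edge $e$ is the union of the midcubes $\{x_i=0\}$ of those cubes whose edges in the direction $i$ are parallel to $e$ up to orientation; these edges are said to be dual to $H$. The complex $X$ is special if it is NPC and has 1. no one-sided hyperplane (no oriented edge is parallel to its reverse); 2. no self-intersecting hyperplane (no square has two consecutive edges dual to the same hyperplane); 3. no directly self-osculating hyperplane (no two distinct parallel oriented edges start at the same vertex without being consecutive edges of a square there); 4. no interosculating pair of hyperplanes (no two distinct hyperplanes cross in some square and also have dual edges that share a vertex without being consecutive edges of a square there). A hyperplane $H$ is separating if $X\setminus H$ has more than one connected component. **Proposition.** Let $X$ be a connected special cube complex, $H$ a separating hyperplane of $X$, and $\overline N_1(H)$ its closed unit neighbourhood, i.e. the union of the closed cubes that meet $H$. Then there is a homeomorphism $H\times[-1,1]\cong\overline N_1(H)$ that is a product structure: for every cube $\Phi:[-1,1]^n\to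 X$ with a midcube $\{x_i=0\}$ in $H$ there is a sign $\varepsilon=\pm1$ such that it maps $(\Phi(x_1,\dots,0,\dots,x_n),\varepsilon x_i)$ to $\Phi(x_1,\dots,x_i,\dots,x_n)$ for all $x$. Moreover, for every such product structure, let the collapse $X/H$ be the quotient space of $X$ by the identifications $(p,s)\sim(p,t)$ for $p\in H$ and $s,t\in[-1,1]$, with quotient map $\pi:X\to X/H$. Then $X/H$ is a cube complex whose cubes are the images under $\pi$ of the cubes of $X$ that do not meet $H$, and this cube complex is NPC and special. -/

import Mathlib

open Set Topology

namespace CubeCx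

universe u

/-- The interval `[-1,1]`. -/
abbrev Interval : Type := Set.Icc (-1 : ℝ) 1

/-- The left end `-1` of the interval. -/
def left : Interval := ⟨-1, by norm_num⟩

/-- The midpoint `0` of the interval. -/
def mid : Interval := ⟨0, by norm_num⟩

/-- The right end `1` of the interval. -/
def right : Interval := ⟨1, by norm_num⟩

/-- The reflection `t ↦ -t` of the interval. -/
def neg (t : Interval) : Interval :=
  ⟨-t.1, by have h := t.2.1; have h' := t.2.2; constructor <;> linarith⟩

/-- Apply the reflection `t ↦ -t` if the sign is `true`, and the identity otherwise. -/
def flip (s : Bool) (t : Interval) : Interval := if s then neg t else t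

/-- The standard `n`-cube `[-1,1]^n`. -/
abbrev Cube (n : ℕ) : Type := Fin n → Interval

/-- The open `n`-cube `(-1,1)^n`. -/
def openCube (n : ℕ) : Set (Cube n) := {x | ∀ i, -1 < (x i : ℝ) ∧ (x i : ℝ) < 1}

/-- The corner `(-1,…,-1)` of the `n`-cube. -/
def corner (n : ℕ) : Cube n := fun _ => left

/-- An isometry of the cube `[-1,1]^m` onto a face of the cube `[-1,1]^n`: every coordinate `j` of
the target is either `± x i` for one source coordinate `i` (`coord j = some i`), or a constant `± 1`
(`coord j = none`), and every source coordinate is used exactly once. For `m = n` these are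
the symmetries of the cube. -/
structure FaceMap (m n : ℕ) where
  coord : Fin n → Option (Fin m)
  sign : Fin n → Bool
  used_once : ∀ i : Fin m, ∃! j : Fin n, coord j = some i

/-- The map of cubes underlying a face map. -/
def FaceMap.map {m n : ℕ} (g : FaceMap m n) (x : Cube m) : Cube n :=
  fun j => flip (g.sign j) ((g.coord j).elim right x)

/-- A (finite-dimensional) cube complex structure on a topological space `X`, that is, a
presentation of `X` as a space glued from standard cubes by isometries between faces.
`cubes n` is the set of all parametrized `n`-cubes `[-1,1]^n → X`; an `n`-cube of `X` appears in
it once with each of the `2^n n!` parametrizations that differ by a symmetry of `[-1,1]^n`. -/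
structure CubeComplex (X : Type u) [TopologicalSpace X] where
  cubes : ∀ n : ℕ, Set (Cube n → X)
  /-- Faces of cubes, with any isometric parametrization, are cubes. -/
  face_mem : ∀ {m n : ℕ} (Φ : Cube n → X) (g : FaceMap m n), Φ ∈ cubes n → Φ ∘ g.map ∈ cubes m
  /-- Open cubes are embedded. -/
  injOn : ∀ {n : ℕ} (Φ : Cube n → X), Φ ∈ cubes n → Set.InjOn Φ (openCube n)
  /-- The open cubes cover. -/
  cover : ∀ p : X, ∃ (n : ℕ) (Φ : Cube n → X) (x : Cube n), Φ ∈ cubes n ∧ x ∈ openCube n ∧ Φ x = p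
  /-- Two cubes whose interiors meet are the same cube, up to a symmetry of the parameter cube. -/
  eq_of_meet : ∀ {m n : ℕ} (Φ : Cube m → X) (Ψ : Cube n → X) (x : Cube m) (y : Cube n),
    Φ ∈ cubes m → Ψ ∈ cubes n → x ∈ openCube m → y ∈ openCube n → Φ x = Ψ y →
      m = n ∧ ∃ g : FaceMap n m, Ψ = Φ ∘ g.map
  /-- The topology of `X` is the quotient topology given by the cubes. -/
  isClosed_iff : ∀ s : Set X,
    IsClosed s ↔ ∀ (n : ℕ) (Φ : Cube n → X), Φ ∈ cubes n → IsClosed (Φ ⁻¹' s)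
  /-- The dimension is finite. -/
  finite_dim : ∃ N : ℕ, ∀ n : ℕ, N < n → cubes n = ∅

/-- The `i`-th oriented edge of the parametrized cube `Φ` that starts at its corner
`Φ (-1,…,-1)`. -/
def edge {X : Type u} {n : ℕ} (Φ : Cube n → X) (i : Fin n) : Cube 1 → X :=
  fun t => Φ (Function.update (corner n) i (t 0))

/-- The same edge with the opposite orientation. -/
def reverse {X : Type u} (e : Cube 1 → X) : Cube 1 → X := fun t => e (fun _ => neg (t 0))

namespace CubeComplex

variable {X : Type u} [TopologicalSpace X] (C : CubeComplex X)

/-! ### Links and non-positive curvature -/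

/-- `e` and `f` are (oriented) edges that start at the same vertex and are consecutive edges of a
square there; in other words, they are adjacent vertices of the link. -/
def SpanSquare (e f : Cube 1 → X) : Prop :=
  ∃ Φ ∈ C.cubes 2, edge Φ 0 = e ∧ edge Φ 1 = f

/-- Gromov's link condition: the link of every vertex is a flag simplicial complex. The vertices of
the link of `v` are the oriented edges that start at `v`, and a cube `Φ` with a corner at
`v = Φ (-1,…,-1)` gives the simplex with vertices `edge Φ i`. -/
structure IsNPC : Prop where
  /-- The vertices of a simplex of the link are distinct. -/
  distinct_vertices : ∀ {n : ℕ} (Φ : Cube n → X), Φ ∈ C.cubes n → Function.Injective (edge Φ)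
  /-- A simplex of the link is determined by its vertices. -/
  determined : ∀ {n : ℕ} (Φ Ψ : Cube n → X), Φ ∈ C.cubes n → Ψ ∈ C.cubes n →
    Φ (corner n) = Ψ (corner n) → (∀ i, edge Φ i = edge Ψ i) → Φ = Ψ
  /-- Pairwise adjacent vertices of the link span a simplex. -/
  flag : ∀ {n : ℕ} (v : Cube 0 → X) (ε : Fin n → Cube 1 → X), v ∈ C.cubes 0 →
    (∀ i, ε i ∈ C.cubes 1 ∧ ε i (corner 1) = v (corner 0)) → Function.Injective ε →
    (∀ i j, i ≠ j → C.SpanSquare (ε i) (ε j)) →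
      ∃ Φ ∈ C.cubes n, Φ (corner n) = v (corner 0) ∧ ∀ i, edge Φ i = ε i

/-! ### Hyperplanes -/

/-- `e` and `e'` are opposite edges of a square, with the same orientation. -/
def ElemParallel (e e' : Cube 1 → X) : Prop :=
  ∃ Φ ∈ C.cubes 2, (e = fun t => Φ ![t 0, left]) ∧ (e' = fun t => Φ ![t 0, right])

/-- Parallelism of oriented edges: the equivalence relation generated by `ElemParallel`. -/
def Parallel (e e' : Cube 1 → X) : Prop := Relation.EqvGen C.ElemParallel e e'

/-- The edges `e` and `e'` are dual to the same hyperplane. -/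
def SameHyperplane (e e' : Cube 1 → X) : Prop := C.Parallel e e' ∨ C.Parallel e (reverse e')

/-- The hyperplane dual to the edge `e`: the union of the midcubes `{x i = 0}` of those cubes whose
edges in the direction `i` are parallel to `e`, up to orientation. -/
def hyperplane (e : Cube 1 → X) : Set X :=
  {p | ∃ (n : ℕ) (Φ : Cube n → X) (i : Fin n) (x : Cube n),
    Φ ∈ C.cubes n ∧ C.SameHyperplane e (edge Φ i) ∧ x i = mid ∧ Φ x = p}

/-- `H` is a hyperplane of the cube complex. -/
def IsHyperplane (H : Set X) : Prop := ∃ e ∈ C.cubes 1, H = C.hyperplane e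

/-- The hyperplane dual to `e` is one-sided. -/
def OneSided (e : Cube 1 → X) : Prop := C.Parallel e (reverse e)

/-- The hyperplanes dual to `e` and `f` cross in some square. (With `e = f`, the hyperplane
intersects itself.) -/
def Cross (e f : Cube 1 → X) : Prop :=
  ∃ Φ ∈ C.cubes 2, C.SameHyperplane e (edge Φ 0) ∧ C.SameHyperplane f (edge Φ 1)

/-- The edges `e ≠ f` start at the same vertex and are not consecutive in a square there. -/
def OsculateAt (e f : Cube 1 → X) : Prop :=
  e ≠ f ∧ e (corner 1) = f (corner 1) ∧ ¬ C.SpanSquare e f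

/-- A cube complex is special if it is non-positively curved and has no one-sided hyperplane, no
self-intersecting hyperplane, no directly self-osculating hyperplane and no pair of
interosculating hyperplanes. -/
structure IsSpecial : Prop where
  npc : C.IsNPC
  no_one_sided : ∀ e ∈ C.cubes 1, ¬ C.OneSided e
  no_self_intersection : ∀ e ∈ C.cubes 1, ¬ C.Cross e e
  no_direct_self_osculation : ∀ e ∈ C.cubes 1, ∀ f ∈ C.cubes 1,
    C.Parallel e f → ¬ C.OsculateAt e f
  no_interosculation : ∀ e ∈ C.cubes 1, ∀ f ∈ C.cubes 1,
    ¬ C.SameHyperplane e f → C.Cross e f → ¬ C.OsculateAt e f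

/-- `H` is separating: its complement has more than one connected component. -/
def IsSeparating (H : Set X) : Prop := Nontrivial (ConnectedComponents (Hᶜ : Set X))

/-! ### The product neighbourhood of a hyperplane and the collapse -/

/-- The closed unit neighbourhood of a hyperplane `H`. As all edges have length `2`, it is the
union of the closed cubes that meet `H`. -/
def unitNbhd (H : Set X) : Set X :=
  {p | ∃ (n : ℕ) (Φ : Cube n → X), Φ ∈ C.cubes n ∧ (Set.range Φ ∩ H).Nonempty ∧ p ∈ Set.range Φ}

/-- A homeomorphism from `H × [-1,1]` to the closed unit neighbourhood of `H` is a product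
structure if it is the evident one on every cube: whenever `H` contains the midcube `{x i = 0}`
of `Φ`, it maps `(Φ (x₁,…,0,…,xₙ), ± x i)` to `Φ (x₁,…,x i,…,xₙ)`, with a sign that depends only on
`Φ` and `i`. -/
def IsProductStructure (H : Set X) (h : (H × Interval) ≃ₜ C.unitNbhd H) : Prop :=
  ∀ (n : ℕ) (Φ : Cube n → X) (i : Fin n), Φ ∈ C.cubes n → (∀ x : Cube n, x i = mid → Φ x ∈ H) →
    ∃ s : Bool, ∀ (x : Cube n) (p : H), (p : X) = Φ (Function.update x i mid) →
      (h (p, flip s (x i)) : X) = Φ x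

/-- The identification `(p,s) ∼ (p,t)` on the product neighbourhood. -/
def collapseRel {H : Set X} (h : (H × Interval) ≃ₜ C.unitNbhd H) (x y : X) : Prop :=
  ∃ (p : H) (s t : Interval), x = h (p, s) ∧ y = h (p, t)

/-- The collapse `X/H`, with the quotient topology. -/
abbrev Collapse {H : Set X} (h : (H × Interval) ≃ₜ C.unitNbhd H) : Type u := Quot (C.collapseRel h)

/-- The cubes of the collapse: the images of the cubes of `X` that do not meet `H`. -/
def collapseCubes {H : Set X} (h : (H × Interval) ≃ₜ C.unitNbhd H) (n : ℕ) :
    Set (Cube n → C.Collapse h) :=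
  {Ψ | ∃ Φ ∈ C.cubes n, Disjoint (Set.range Φ) H ∧ Ψ = Quot.mk (C.collapseRel h) ∘ Φ}

end CubeComplex

end CubeCx

/-!
A cube is handled through its parametrizations, and all incidence questions are reduced to one fact
(`common_face`): if two cubes share a point, they share the face in whose interior it lies.
Consequently the hyperplane `H` of an edge `e` meets a cube in the midcubes of its directions that
are dual to `H` (`mem_hyperplane_iff`), and there is at most one such direction, as `H` does not
intersect itself.

*Sides.* `SideRel` relates vertices that are joined by a path of edges not dual to `H`. If the ends
of one edge dual to `H` were related, so would be the ends of all of them, hence all vertices, and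
the complement of `H` would be connected. So every edge dual to `H` joins different sides
(`IsSpecial.not_sideRel`). In particular no vertex is the start of one edge and the end of another
one that are parallel to `e`; together with the absence of direct self-osculation, a vertex lies on
at most one edge dual to `H` (`SeparatingEdge.edge_unique`).

*Product structure.* Orient the segments across `H` like `e`. Two of them that meet are equal
(`SeparatingEdge.segment_unique`), so that they define a bijection from `H × [-1,1]` to the
neighbourhood. Both `H` and the neighbourhood carry the quotient topology from the disjoint union of
the cubes that meet `H`; as `[-1,1]` is locally compact, the product with it of the first of these
quotient maps can be used to check continuity, and the bijection is a homeomorphism.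

*Collapse.* For every product structure, the quotient map `π` identifies exactly the points on
common segments across `H` (`IsProductStructure.collapseRel_iff`). Hence two cubes that do not meet
`H` have the same image if and only if they are equal or opposite facets of a cube crossed by `H`
(`Opp`), and in the second case they are on different sides. This yields the cube complex
(`IsCollapseMap.complex`). For the link condition and the conditions on hyperplanes, the given edges
are lifted to edges that start at a common vertex, which reduces the claim to the one for the
original complex. If the lifts start at the two ends of an edge `k` dual to `H`, one of them has to
be moved across `H`. In the link condition this is possible by flagness applied to `k` and the edges
of the cube (`SeparatingEdge.exists_extension`). For osculations, it is possible if the hyperplane of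
one of the edges crosses `H`, as it does not interosculate with `H`
(`SeparatingEdge.exists_opp_of_cross`); otherwise these hyperplanes stay on one side of `H` each
(`SameHyperplane.sideRel_of_not_cross`), so that they are neither equal nor crossing.
-/

namespace CubeCx

universe u

/-! ### The interval and its ends -/

/-- A point of the open interval `(-1,1)`. -/
def IsInner (t : Interval) : Prop := -1 < (t : ℝ) ∧ (t : ℝ) < 1

/-- One of the two ends `±1` of the interval. -/
def IsEnd (t : Interval) : Prop := t = left ∨ t = right

theorem isEnd_left : IsEnd left := Or.inl rfl

theorem isEnd_right : IsEnd right := Or.inr rfl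

theorem isInner_mid : IsInner mid := by constructor <;> norm_num [mid]

theorem not_isInner_iff {t : Interval} : ¬ IsInner t ↔ IsEnd t := by
  have h1 := t.2.1
  have h2 := t.2.2
  unfold IsInner IsEnd left right
  simp only [Subtype.ext_iff]
  constructor
  · intro h
    by_contra! h'
    exact h ⟨lt_of_le_of_ne h1 (Ne.symm h'.1), lt_of_le_of_ne h2 h'.2⟩
  · rintro (h | h) ⟨h3, h4⟩ <;> simp only [h] at h3 h4 <;> linarith

theorem IsInner.not_isEnd {t : Interval} (h : IsInner t) : ¬ IsEnd t :=
  fun h' => not_isInner_iff.2 h' h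

theorem left_ne_right : left ≠ right := by
  intro h
  have := congrArg Subtype.val h
  norm_num [left, right] at this

theorem left_ne_mid : left ≠ mid := fun h => isInner_mid.not_isEnd (h ▸ isEnd_left)

@[simp] theorem neg_neg (t : Interval) : neg (neg t) = t := Subtype.ext (by simp [neg])

@[simp] theorem neg_left : neg left = right := Subtype.ext (by simp [neg, left, right])

@[simp] theorem neg_right : neg right = left := Subtype.ext (by simp [neg, left, right])

@[simp] theorem neg_mid : neg mid = mid := Subtype.ext (by simp [neg, mid])

@[simp] theorem flip_false (t : Interval) : flip false t = t := rfl

@[simp] theorem flip_true (t : Interval) : flip true t = neg t := rfl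

@[simp] theorem flip_flip (s : Bool) (t : Interval) : flip s (flip s t) = t := by
  cases s <;> simp

@[simp] theorem flip_mid (s : Bool) : flip s mid = mid := by cases s <;> simp

theorem flip_xor (a b : Bool) (t : Interval) : flip (xor a b) t = flip a (flip b t) := by
  cases a <;> cases b <;> simp

theorem isInner_flip {s : Bool} {t : Interval} : IsInner (flip s t) ↔ IsInner t := by
  cases s
  · rfl
  · simp only [flip_true, IsInner, neg]
    constructor <;> rintro ⟨h, h'⟩ <;> constructor <;> linarith

theorem isEnd_flip {s : Bool} {t : Interval} : IsEnd (flip s t) ↔ IsEnd t := by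
  rw [← not_isInner_iff, ← not_isInner_iff, isInner_flip]

theorem continuous_neg' : Continuous neg :=
  Continuous.subtype_mk (continuous_subtype_val.neg) _

theorem continuous_flip (s : Bool) : Continuous (flip s) := by
  cases s
  · exact continuous_id
  · exact continuous_neg'

/-- All coordinates are `±1`. -/
def IsCorner {n : ℕ} (x : Cube n) : Prop := ∀ i, IsEnd (x i)

theorem isCorner_corner (n : ℕ) : IsCorner (corner n) := fun _ => isEnd_left

theorem IsCorner.update {n : ℕ} {x : Cube n} (hx : IsCorner x) (i : Fin n) {t : Interval}
    (ht : IsEnd t) : IsCorner (Function.update x i t) := by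
  intro j
  by_cases h : j = i
  · subst h; simpa using ht
  · simpa [h] using hx j

theorem vecCons_mem_openCube {n : ℕ} {t : Interval} {w : Cube n} (ht : IsInner t)
    (hw : w ∈ openCube n) : (Matrix.vecCons t w : Cube (n + 1)) ∈ openCube (n + 1) := by
  intro i
  refine Fin.cases ?_ (fun j => ?_) i
  · exact ht
  · exact hw j

theorem vecCons_left_corner (n : ℕ) :
    (Matrix.vecCons left (corner n) : Cube (n + 1)) = corner (n + 1) := by
  ext i
  refine Fin.cases ?_ (fun j => ?_) i <;> rfl

theorem update_vecCons_zero {n : ℕ} (s t : Interval) (w : Cube n) :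
    Function.update (Matrix.vecCons s w : Cube (n + 1)) 0 t = Matrix.vecCons t w := by
  ext i
  refine Fin.cases ?_ (fun j => ?_) i
  · simp
  · simp [Fin.succ_ne_zero]

theorem update_vecCons_succ {n : ℕ} (s t : Interval) (w : Cube n) (i : Fin n) :
    Function.update (Matrix.vecCons s w : Cube (n + 1)) i.succ t =
      Matrix.vecCons s (Function.update w i t) := by
  ext j
  refine Fin.cases ?_ (fun j => ?_) j
  · simp [(Fin.succ_ne_zero _).symm]
  · by_cases h : j = i
    · subst h; simp
    · simp [h]

theorem vecCons_head_tail {n : ℕ} (x : Cube (n + 1)) :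
    (Matrix.vecCons (x 0) (fun i => x i.succ) : Cube (n + 1)) = x := by
  ext i
  refine Fin.cases ?_ (fun j => ?_) i <;> rfl

theorem cube_one_eta (x : Cube 1) : (fun _ => x 0) = x := by
  ext i; rw [Subsingleton.elim i 0]

/-- To relate two points of a cube by a preorder, it suffices to replace the coordinates of the
first point by those of the second one at a time. -/
theorem coordinate_walk {n : ℕ} (r : Cube n → Cube n → Prop) (hr : ∀ x, r x x)
    (ht : ∀ x y z, r x y → r y z → r x z) (y z : Cube n)
    (hstep : ∀ (w : Cube n) (j : Fin n), (∀ k, w k = y k ∨ w k = z k) → y j ≠ z j → w j = y j →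
      r w (Function.update w j (z j))) : r y z := by
  classical
  have key : ∀ S : Finset (Fin n), r y (S.piecewise z y) := by
    intro S
    induction S using Finset.induction_on with
    | empty => simpa using hr y
    | insert j S hj ih =>
      rw [Finset.piecewise_insert]
      by_cases hjz : y j = z j
      · rw [show Function.update (S.piecewise z y) j (z j) = S.piecewise z y from ?_]
        · exact ih
        · rw [Function.update_eq_self_iff, Finset.piecewise_eq_of_notMem _ _ _ hj, hjz]
      · refine ht _ _ _ ih (hstep _ j (fun k => ?_) hjz (Finset.piecewise_eq_of_notMem _ _ _ hj))
        by_cases hk : k ∈ S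
        · right; exact Finset.piecewise_eq_of_mem _ _ _ hk
        · left; exact Finset.piecewise_eq_of_notMem _ _ _ hk
  have := key Finset.univ
  rwa [Finset.piecewise_univ] at this

/-! ### Face maps -/

namespace FaceMap

/-- The target coordinate in which the source coordinate `i` is used. -/
noncomputable def inj {m n : ℕ} (g : FaceMap m n) (i : Fin m) : Fin n := (g.used_once i).choose

theorem coord_inj {m n : ℕ} (g : FaceMap m n) (i : Fin m) : g.coord (g.inj i) = some i :=
  (g.used_once i).choose_spec.1

theorem eq_inj {m n : ℕ} (g : FaceMap m n) {i : Fin m} {j : Fin n} (h : g.coord j = some i) :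
    j = g.inj i := (g.used_once i).choose_spec.2 j h

theorem inj_injective {m n : ℕ} (g : FaceMap m n) : Function.Injective g.inj := fun i j h => by
  have := g.coord_inj i
  rw [h, g.coord_inj] at this
  exact (Option.some.inj this).symm

theorem map_inj {m n : ℕ} (g : FaceMap m n) (x : Cube m) (i : Fin m) :
    g.map x (g.inj i) = flip (g.sign (g.inj i)) (x i) := by
  simp [map, coord_inj]

theorem map_none {m n : ℕ} (g : FaceMap m n) (x : Cube m) {j : Fin n} (h : g.coord j = none) :
    g.map x j = flip (g.sign j) right := by
  simp [map, h]

theorem isEnd_map_none {m n : ℕ} (g : FaceMap m n) (x : Cube m) {j : Fin n}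
    (h : g.coord j = none) : IsEnd (g.map x j) := by
  rw [map_none g x h, isEnd_flip]; exact isEnd_right

theorem coord_cases {m n : ℕ} (g : FaceMap m n) (j : Fin n) :
    g.coord j = none ∨ ∃ i, j = g.inj i := by
  cases h : g.coord j with
  | none => exact Or.inl rfl
  | some i => exact Or.inr ⟨i, g.eq_inj h⟩

theorem isCorner_map {m n : ℕ} (g : FaceMap m n) {x : Cube m} (hx : IsCorner x) :
    IsCorner (g.map x) := by
  intro j
  rcases g.coord_cases j with h | ⟨i, rfl⟩
  · exact g.isEnd_map_none x h
  · rw [map_inj, isEnd_flip]; exact hx i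

theorem map_update {m n : ℕ} (g : FaceMap m n) (x : Cube m) (i : Fin m) (t : Interval) :
    g.map (Function.update x i t) =
      Function.update (g.map x) (g.inj i) (flip (g.sign (g.inj i)) t) := by
  ext j
  congr 1
  by_cases hj : j = g.inj i
  · subst hj; simp [map_inj]
  · rcases g.coord_cases j with h | ⟨i', rfl⟩
    · rw [Function.update_of_ne hj, map_none g _ h, map_none g _ h]
    · have : i' ≠ i := fun h => hj (by rw [h])
      rw [Function.update_of_ne hj, map_inj, map_inj, Function.update_of_ne this]

theorem exists_inj_of_isInner {m n : ℕ} (g : FaceMap m n) {x : Cube m} {j : Fin n}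
    (h : IsInner (g.map x j)) : ∃ i, j = g.inj i ∧ IsInner (x i) := by
  rcases g.coord_cases j with h' | ⟨i, rfl⟩
  · exact absurd (g.isEnd_map_none x h') h.not_isEnd
  · rw [map_inj, isInner_flip] at h
    exact ⟨i, rfl, h⟩

theorem exists_inj {n : ℕ} (g : FaceMap n n) (j : Fin n) : ∃ i, j = g.inj i := by
  obtain ⟨i, hi⟩ := (Finite.injective_iff_surjective.1 g.inj_injective) j
  exact ⟨i, hi.symm⟩

theorem map_mem_openCube {n : ℕ} (g : FaceMap n n) {x : Cube n} (hx : x ∈ openCube n) :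
    g.map x ∈ openCube n := by
  intro j
  obtain ⟨i, rfl⟩ := g.exists_inj j
  rw [map_inj]
  exact isInner_flip.2 (hx i)

theorem continuous_map {m n : ℕ} (g : FaceMap m n) : Continuous g.map := by
  refine continuous_pi fun j => ?_
  refine (continuous_flip _).comp ?_
  cases g.coord j with
  | none => exact continuous_const
  | some i => exact continuous_apply i

/-- Composition of face maps. -/
def comp {k m n : ℕ} (g : FaceMap m n) (f : FaceMap k m) : FaceMap k n where
  coord j := (g.coord j).bind f.coord
  sign j := xor (g.sign j) ((g.coord j).elim false f.sign)
  used_once i := by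
    refine ⟨g.inj (f.inj i), by simp [coord_inj], fun j hj => ?_⟩
    obtain ⟨l, hl, hl'⟩ := Option.bind_eq_some_iff.1 hj
    rw [g.eq_inj hl, f.eq_inj hl']

theorem comp_map {k m n : ℕ} (g : FaceMap m n) (f : FaceMap k m) :
    (g.comp f).map = g.map ∘ f.map := by
  ext x j
  congr 1
  cases h : g.coord j with
  | none => simp [map, comp, h]
  | some l => simp [map, comp, h, flip_xor]

/-- The face map with given position `σ` and signs `s` of the coordinates. -/
noncomputable def ofInj {m n : ℕ} (σ : Fin m → Fin n) (hσ : Function.Injective σ)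
    (s : Fin n → Bool) : FaceMap m n where
  coord := Function.extend σ some (fun _ => none)
  sign := s
  used_once i := by
    refine ⟨σ i, by simp [hσ.extend_apply], fun j hj => ?_⟩
    by_cases h : ∃ a, σ a = j
    · obtain ⟨a, rfl⟩ := h
      rw [hσ.extend_apply] at hj
      rw [Option.some.inj hj]
    · have hj : Function.extend σ some (fun _ => none) j = some i := hj
      rw [Function.extend_apply' _ _ _ h] at hj
      exact absurd hj (by simp)

theorem ofInj_inj {m n : ℕ} (σ : Fin m → Fin n) (hσ : Function.Injective σ) (s : Fin n → Bool) :
    (ofInj σ hσ s).inj = σ := by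
  ext i
  rw [← (ofInj σ hσ s).eq_inj (j := σ i) (i := i)]
  simp [ofInj, hσ.extend_apply]

open Classical in
/-- The face of the cube that is spanned by the directions `σ` and contains the point `x`, whose
other coordinates are supposed to be `±1`. -/
noncomputable def faceAt {m n : ℕ} (σ : Fin m → Fin n) (hσ : Function.Injective σ) (x : Cube n) :
    FaceMap m n :=
  ofInj σ hσ (fun j => decide ((∀ i, σ i ≠ j) ∧ x j = left))

theorem faceAt_inj {m n : ℕ} (σ : Fin m → Fin n) (hσ : Function.Injective σ) (x : Cube n) :
    (faceAt σ hσ x).inj = σ := ofInj_inj _ _ _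

theorem faceAt_map {m n : ℕ} {σ : Fin m → Fin n} (hσ : Function.Injective σ) {x : Cube n}
    {y : Cube m} {z : Cube n} (h1 : ∀ i, z (σ i) = y i)
    (h2 : ∀ j, (∀ i, σ i ≠ j) → z j = x j ∧ IsEnd (x j)) : (faceAt σ hσ x).map y = z := by
  classical
  ext j
  congr 1
  by_cases h : ∃ i, σ i = j
  · obtain ⟨i, rfl⟩ := h
    have := (faceAt σ hσ x).map_inj y i
    rw [faceAt_inj] at this
    have hs : (faceAt σ hσ x).sign (σ i) = false := by
      simp only [faceAt, ofInj, decide_eq_false_iff_not, not_and]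
      intro h
      exact absurd rfl (h i)
    rw [this, h1, hs, flip_false]
  · have hj : ∀ i, σ i ≠ j := fun i hi => h ⟨i, hi⟩
    rw [map_none _ _ (by simp [faceAt, ofInj, Function.extend_apply' _ _ _ h]), (h2 j hj).1]
    have hr : right ≠ left := left_ne_right.symm
    rcases (h2 j hj).2 with h' | h' <;> simp [faceAt, ofInj, hj, h', hr]

/-- The facet `{x 0 = 1}` (for `s = false`) or `{x 0 = -1}` (for `s = true`) of the cube. -/
def facet (s : Bool) (n : ℕ) : FaceMap n (n + 1) where
  coord := Matrix.vecCons none some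
  sign := Matrix.vecCons s (fun _ => false)
  used_once i := by
    refine ⟨i.succ, rfl, fun j => ?_⟩
    refine Fin.cases ?_ (fun l => ?_) j
    · simp
    · simp

theorem facet_map (s : Bool) {n : ℕ} (w : Cube n) :
    (facet s n).map w = Matrix.vecCons (flip s right) w := by
  ext j
  refine Fin.cases ?_ (fun l => ?_) j <;> rfl

theorem facet_inj (s : Bool) {n : ℕ} (i : Fin n) : (facet s n).inj i = i.succ :=
  ((facet s n).eq_inj (by simp [facet])).symm

/-- The product of the face map `g` with the identity (for `s = false`) or the reflection (for
`s = true`) of an additional first coordinate. -/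
def consMap (s : Bool) {m n : ℕ} (g : FaceMap m n) : FaceMap (m + 1) (n + 1) where
  coord := Matrix.vecCons (some 0) (fun j => (g.coord j).map Fin.succ)
  sign := Matrix.vecCons s g.sign
  used_once i := by
    refine Fin.cases ?_ (fun l => ?_) i
    · refine ⟨0, rfl, fun j => ?_⟩
      refine Fin.cases (fun _ => rfl) (fun l h => ?_) j
      simp only [Matrix.cons_val_succ, Option.map_eq_some_iff] at h
      obtain ⟨a, -, ha⟩ := h
      exact absurd ha (Fin.succ_ne_zero a)
    · refine ⟨(g.inj l).succ, by simp [coord_inj], fun j => ?_⟩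
      refine Fin.cases (fun h => ?_) (fun l' h => ?_) j
      · simp only [Matrix.cons_val_zero, Option.some.injEq] at h
        exact absurd h.symm (Fin.succ_ne_zero l)
      · simp only [Matrix.cons_val_succ, Option.map_eq_some_iff] at h
        obtain ⟨a, ha, ha'⟩ := h
        rw [Fin.succ_injective _ ha'] at ha
        rw [g.eq_inj ha]

theorem consMap_map (s : Bool) {m n : ℕ} (g : FaceMap m n) (t : Interval) (w : Cube m) :
    (consMap s g).map (Matrix.vecCons t w) = Matrix.vecCons (flip s t) (g.map w) := by
  ext j
  refine Fin.cases ?_ (fun l => ?_) j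
  · rfl
  · cases h : g.coord l <;> simp [map, consMap, h]

theorem consMap_inj_zero (s : Bool) {m n : ℕ} (g : FaceMap m n) : (consMap s g).inj 0 = 0 :=
  ((consMap s g).eq_inj rfl).symm

/-- The identity of the cube. -/
def idMap (n : ℕ) : FaceMap n n where
  coord := some
  sign _ := false
  used_once i := ⟨i, rfl, fun _ hj => Option.some.inj hj⟩

theorem idMap_map {n : ℕ} (x : Cube n) : (idMap n).map x = x := rfl

/-- A point of the open cube whose coordinates are positive and distinct. -/
noncomputable def generic (n : ℕ) : Cube n := fun i =>
  ⟨((i : ℝ) + 1) / (n + 1), by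
    have : (i : ℝ) + 1 ≤ n := by exact_mod_cast i.2
    constructor
    · have : (0 : ℝ) ≤ ((i : ℝ) + 1) / (n + 1) := by positivity
      linarith
    · rw [div_le_one (by positivity)]; linarith⟩

theorem generic_pos {n : ℕ} (i : Fin n) : 0 < (generic n i : ℝ) := by
  simp only [generic]; positivity

theorem generic_mem (n : ℕ) : generic n ∈ openCube n := by
  intro i
  constructor
  · linarith [generic_pos i]
  · have : (i : ℝ) + 1 ≤ n := by exact_mod_cast i.2
    simp only [generic]
    rw [div_lt_one (by positivity)]; linarith

theorem generic_injective (n : ℕ) : Function.Injective (generic n) := by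
  intro i j h
  have h := congrArg Subtype.val h
  simp only [generic] at h
  rw [div_left_inj' (by positivity)] at h
  have h : (i : ℝ) = j := by linarith
  exact Fin.ext (by exact_mod_cast h)

/-- A face map is determined by the image of a point with positive and distinct coordinates. -/
theorem map_eq_of_generic {m n : ℕ} {g g' : FaceMap m n}
    (h : g.map (generic m) = g'.map (generic m)) : g.map = g'.map := by
  have aux : ∀ (s s' : Bool) (i i' : Fin m),
      flip s (generic m i) = flip s' (generic m i') → s = s' ∧ i = i' := by
    intro s s' i i' h
    have hi := generic_pos i
    have hi' := generic_pos i'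
    have h0 := congrArg Subtype.val h
    cases s <;> cases s' <;> simp only [flip_false, flip_true, neg] at h0
    · exact ⟨rfl, generic_injective m (Subtype.ext h0)⟩
    · linarith
    · linarith
    · exact ⟨rfl, generic_injective m (Subtype.ext (by linarith))⟩
  ext x j
  congr 1
  have hj := congrFun h j
  rcases g.coord_cases j with h1 | ⟨i, rfl⟩
  · rcases g'.coord_cases j with h2 | ⟨i, rfl⟩
    · rw [map_none _ _ h1, map_none _ _ h2] at hj ⊢
      exact hj
    · have : IsInner (g.map (generic m) (g'.inj i)) := by
        rw [hj, map_inj, isInner_flip]; exact generic_mem m i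
      exact absurd (g.isEnd_map_none _ h1) this.not_isEnd
  · have : IsInner (g'.map (generic m) (g.inj i)) := by
      rw [← hj, map_inj, isInner_flip]; exact generic_mem m i
    obtain ⟨i', hi', -⟩ := g'.exists_inj_of_isInner this
    rw [map_inj] at hj ⊢
    rw [hi'] at hj ⊢
    rw [map_inj] at hj ⊢
    obtain ⟨hs, rfl⟩ := aux _ _ _ _ hj
    rw [hs]

theorem finite (m n : ℕ) : Finite (FaceMap m n) := by
  refine Finite.of_injective (fun g : FaceMap m n => (g.coord, g.sign)) ?_
  rintro ⟨c, s, h⟩ ⟨c', s', h'⟩ hg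
  simp only [Prod.mk.injEq] at hg
  obtain ⟨rfl, rfl⟩ := hg
  rfl

theorem le {m n : ℕ} (g : FaceMap m n) : m ≤ n := by
  simpa using Fintype.card_le_of_injective _ g.inj_injective

end FaceMap

open FaceMap

/-- Every point of a cube is interior to a face. -/
theorem exists_carrier {n : ℕ} (x : Cube n) :
    ∃ (m : ℕ) (a : FaceMap m n) (z : Cube m), z ∈ openCube m ∧ a.map z = x := by
  classical
  let F := {j : Fin n // IsInner (x j)}
  let σ : Fin (Fintype.card F) → Fin n := fun i => ((Fintype.equivFin F).symm i).1
  have hσ : Function.Injective σ := Subtype.val_injective.comp (Fintype.equivFin F).symm.injective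
  refine ⟨_, faceAt σ hσ x, fun i => x (σ i), fun i => ((Fintype.equivFin F).symm i).2,
    faceAt_map hσ (fun i => rfl) (fun j hj => ⟨rfl, ?_⟩)⟩
  rw [← not_isInner_iff]
  intro h
  exact hj (Fintype.equivFin F ⟨j, h⟩) (by simp [σ])

/-- A segment in direction `i` through the point `x` of a cube lies in the face that is spanned by
`i` and the other directions in which `x` is interior; parametrize this face with `i` as the first
coordinate. -/
theorem exists_carrier_segment {n : ℕ} (x : Cube n) (i : Fin n) (s : Bool) :
    ∃ (k : ℕ) (a : FaceMap (k + 1) n) (w : Cube k), w ∈ openCube k ∧ a.inj 0 = i ∧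
      a.sign i = s ∧ ∀ t, a.map (Matrix.vecCons t w) = Function.update x i (flip s t) := by
  classical
  let F := {j : Fin n // IsInner (x j) ∧ j ≠ i}
  let τ : Fin (Fintype.card F) → Fin n := fun i => ((Fintype.equivFin F).symm i).1
  have hτ : Function.Injective τ := Subtype.val_injective.comp (Fintype.equivFin F).symm.injective
  have hτ' : ∀ l, τ l ≠ i := fun l => ((Fintype.equivFin F).symm l).2.2
  let σ : Fin (Fintype.card F + 1) → Fin n := Matrix.vecCons i τ
  have hσ : Function.Injective σ := by
    intro a b
    refine Fin.cases ?_ (fun a => ?_) a <;> refine Fin.cases ?_ (fun b => ?_) b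
    · simp
    · intro h; exact absurd h.symm (hτ' b)
    · intro h; exact absurd h (hτ' a)
    · intro h; exact congrArg Fin.succ (hτ h)
  refine ⟨_, (faceAt σ hσ x).comp (consMap s (idMap _)), fun i => x (τ i),
    fun i => ((Fintype.equivFin F).symm i).2.1, ?_, ?_, fun t => ?_⟩
  · refine (FaceMap.eq_inj _ ?_).symm
    simp only [FaceMap.comp]
    rw [show (faceAt σ hσ x).coord i = some 0 from ?_]
    · rfl
    · have := (faceAt σ hσ x).coord_inj 0
      rwa [faceAt_inj] at this
  · have h0 : (faceAt σ hσ x).coord i = some 0 := by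
      have := (faceAt σ hσ x).coord_inj 0
      rwa [faceAt_inj] at this
    have h1 : (faceAt σ hσ x).sign i = false := by
      simp only [faceAt, ofInj, decide_eq_false_iff_not, not_and]
      intro h
      exact absurd rfl (h 0)
    simp [FaceMap.comp, h0, h1, consMap]
  · rw [FaceMap.comp_map, Function.comp_apply, consMap_map]
    refine faceAt_map hσ (fun l => ?_) (fun j hj => ?_)
    · refine Fin.cases ?_ (fun l => ?_) l
      · simp [σ]
      · simp [σ, hτ' l, idMap_map]
    · have hji : j ≠ i := fun h => hj 0 h.symm
      refine ⟨Function.update_of_ne hji _ _, ?_⟩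
      rw [← not_isInner_iff]
      intro h
      exact hj (Fin.succ (Fintype.equivFin F ⟨j, h, hji⟩)) (by simp [σ, τ])

/-! ### Parallel edges -/

/-- The edge `e`, reversed if the sign is `true`. -/
def revIf {X : Type u} (s : Bool) (e : Cube 1 → X) : Cube 1 → X := fun t => e (fun _ => flip s (t 0))

/-- The edge of the cube `Φ` in direction `i` at the corner `y`. -/
def dirEdge {X : Type u} {n : ℕ} (Φ : Cube n → X) (i : Fin n) (y : Cube n) : Cube 1 → X :=
  fun t => Φ (Function.update y i (t 0))

theorem revIf_false {X : Type u} (e : Cube 1 → X) : revIf false e = e := by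
  ext t; simp [revIf, cube_one_eta]

theorem revIf_true {X : Type u} (e : Cube 1 → X) : revIf true e = reverse e := rfl

theorem revIf_revIf {X : Type u} (s t : Bool) (e : Cube 1 → X) :
    revIf s (revIf t e) = revIf (xor t s) e := by
  ext x; simp [revIf, flip_xor]

theorem edge_eq_dirEdge {X : Type u} {n : ℕ} (Φ : Cube n → X) (i : Fin n) :
    edge Φ i = dirEdge Φ i (corner n) := rfl

theorem edge_corner {X : Type u} {n : ℕ} (Φ : Cube n → X) (i : Fin n) :
    edge Φ i (corner 1) = Φ (corner n) := by
  simp only [edge]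
  congr 1
  rw [Function.update_eq_self_iff]; rfl

theorem edge_self {X : Type u} (f : Cube 1 → X) (i : Fin 1) : edge f i = f := by
  ext t
  simp only [edge]
  congr 1
  ext j
  rw [Subsingleton.elim j i, Subsingleton.elim i 0]; simp

theorem dirEdge_comp {X : Type u} {m n : ℕ} (Φ : Cube n → X) (g : FaceMap m n) (i : Fin m)
    (y : Cube m) : dirEdge (Φ ∘ g.map) i y =
      revIf (g.sign (g.inj i)) (dirEdge Φ (g.inj i) (g.map y)) := by
  ext t
  simp [dirEdge, revIf, map_update]

theorem dirEdge_update {X : Type u} {n : ℕ} (Φ : Cube n → X) (i : Fin n) (y : Cube n)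
    (t : Interval) : dirEdge Φ i (Function.update y i t) = dirEdge Φ i y := by
  ext s; simp [dirEdge]

theorem dirEdge_relate {X : Type u} {r : X → X → Prop} (hr : Equivalence r) {n : ℕ} {Φ : Cube n → X}
    {i : Fin n} {w : Cube n} (h : r (dirEdge Φ i w (corner 1)) (dirEdge Φ i w (fun _ => right)))
    {a b : Interval} (ha : IsEnd a) (hb : IsEnd b) :
    r (Φ (Function.update w i a)) (Φ (Function.update w i b)) := by
  rcases ha with rfl | rfl <;> rcases hb with rfl | rfl
  · exact hr.refl _
  · exact h
  · exact hr.symm h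
  · exact hr.refl _

namespace CubeComplex

variable {X : Type u} [TopologicalSpace X] {C : CubeComplex X}

theorem Parallel.refl (e : Cube 1 → X) : C.Parallel e e := Relation.EqvGen.refl e

theorem Parallel.symm {e f : Cube 1 → X} (h : C.Parallel e f) : C.Parallel f e :=
  Relation.EqvGen.symm _ _ h

theorem Parallel.trans {e f g : Cube 1 → X} (h : C.Parallel e f) (h' : C.Parallel f g) :
    C.Parallel e g := Relation.EqvGen.trans _ _ _ h h'

theorem Parallel.revIf {e f : Cube 1 → X} (s : Bool) (h : C.Parallel e f) :
    C.Parallel (revIf s e) (revIf s f) := by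
  induction h with
  | rel a b h =>
    obtain ⟨Φ, hΦ, rfl, rfl⟩ := h
    refine Relation.EqvGen.rel _ _ ⟨_, C.face_mem Φ (consMap s (idMap 1)) hΦ, ?_, ?_⟩ <;>
    · ext t
      simp only [Function.comp_apply, consMap_map, idMap_map, CubeCx.revIf]
  | refl a => exact Parallel.refl _
  | symm a b _ ih => exact ih.symm
  | trans a b c _ _ ih ih' => exact ih.trans ih'

theorem sameHyperplane_iff {e f : Cube 1 → X} :
    C.SameHyperplane e f ↔ ∃ s, C.Parallel e (CubeCx.revIf s f) := by
  simp [SameHyperplane, revIf_false, revIf_true]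

theorem Parallel.sameHyperplane {e f : Cube 1 → X} (h : C.Parallel e f) : C.SameHyperplane e f :=
  Or.inl h

theorem SameHyperplane.symm {e f : Cube 1 → X} (h : C.SameHyperplane e f) :
    C.SameHyperplane f e := by
  rw [sameHyperplane_iff] at h ⊢
  obtain ⟨s, hs⟩ := h
  refine ⟨s, ?_⟩
  have := hs.symm.revIf s
  rwa [revIf_revIf, Bool.xor_self, revIf_false] at this

theorem SameHyperplane.trans {e f g : Cube 1 → X} (h : C.SameHyperplane e f)
    (h' : C.SameHyperplane f g) : C.SameHyperplane e g := by
  rw [sameHyperplane_iff] at h h' ⊢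
  obtain ⟨s, hs⟩ := h
  obtain ⟨t, ht⟩ := h'
  have := ht.revIf s
  rw [revIf_revIf] at this
  exact ⟨_, hs.trans this⟩

theorem sameHyperplane_revIf (s : Bool) (e : Cube 1 → X) :
    C.SameHyperplane e (CubeCx.revIf s e) := by
  rw [sameHyperplane_iff]
  exact ⟨s, by rw [revIf_revIf, Bool.xor_self, revIf_false]; exact Parallel.refl e⟩

theorem sameHyperplane_revIf_iff {s : Bool} {e f : Cube 1 → X} :
    C.SameHyperplane e (CubeCx.revIf s f) ↔ C.SameHyperplane e f :=
  ⟨fun h => h.trans (sameHyperplane_revIf s f).symm, fun h => h.trans (sameHyperplane_revIf s f)⟩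

theorem Parallel.sameHyperplane_iff {e f g : Cube 1 → X} (h : C.Parallel f g) :
    C.SameHyperplane e f ↔ C.SameHyperplane e g :=
  ⟨fun h' => h'.trans h.sameHyperplane, fun h' => h'.trans h.symm.sameHyperplane⟩

theorem parallel_of_square {Φ : Cube 2 → X} (hΦ : Φ ∈ C.cubes 2) {a b : Interval} (ha : IsEnd a)
    (hb : IsEnd b) : C.Parallel (fun t => Φ ![t 0, a]) (fun t => Φ ![t 0, b]) := by
  have key : C.Parallel (fun t => Φ ![t 0, left]) (fun t => Φ ![t 0, right]) :=
    Relation.EqvGen.rel _ _ ⟨Φ, hΦ, rfl, rfl⟩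
  rcases ha with rfl | rfl <;> rcases hb with rfl | rfl
  · exact Parallel.refl _
  · exact key
  · exact key.symm
  · exact Parallel.refl _

theorem pair_injective {n : ℕ} {i j : Fin n} (h : i ≠ j) : Function.Injective ![i, j] := by
  intro a b hab
  fin_cases a <;> fin_cases b <;> simp_all

/-- The square in directions `i` and `j` at a corner of a cube. -/
theorem faceAt_pair_map {n : ℕ} {i j : Fin n} (h : i ≠ j) {y : Cube n} (hy : IsCorner y)
    (s t : Interval) : (faceAt ![i, j] (pair_injective h) y).map ![s, t] =
      Function.update (Function.update y i s) j t := by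
  refine faceAt_map _ (fun l => ?_) (fun l hl => ⟨?_, hy l⟩)
  · fin_cases l
    · simp [h]
    · simp
  · have h0 : l ≠ i := fun h' => hl 0 h'.symm
    have h1 : l ≠ j := fun h' => hl 1 h'.symm
    simp [h0, h1]

theorem dirEdge_mem {n : ℕ} {Φ : Cube n → X} (hΦ : Φ ∈ C.cubes n) (i : Fin n) {y : Cube n}
    (hy : IsCorner y) : dirEdge Φ i y ∈ C.cubes 1 := by
  have hσ : Function.Injective (fun _ : Fin 1 => i) := fun a b _ => Subsingleton.elim a b
  convert C.face_mem Φ (faceAt (fun _ : Fin 1 => i) hσ y) hΦ using 1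
  ext t
  simp only [dirEdge, Function.comp_apply]
  congr 1
  refine (faceAt_map _ (fun l => ?_) (fun j hj => ⟨?_, hy j⟩)).symm
  · simp [Subsingleton.elim l 0]
  · exact Function.update_of_ne (fun h => hj 0 h.symm) _ _

theorem edge_mem {n : ℕ} {Φ : Cube n → X} (hΦ : Φ ∈ C.cubes n) (i : Fin n) :
    edge Φ i ∈ C.cubes 1 := dirEdge_mem hΦ i (isCorner_corner n)

theorem dirEdge_parallel {n : ℕ} {Φ : Cube n → X} (hΦ : Φ ∈ C.cubes n) (i : Fin n) {y z : Cube n}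
    (hy : IsCorner y) (hz : IsCorner z) : C.Parallel (dirEdge Φ i y) (dirEdge Φ i z) := by
  refine coordinate_walk (fun y z => C.Parallel (dirEdge Φ i y) (dirEdge Φ i z))
    (fun x => Parallel.refl _) (fun x y z h h' => h.trans h') y z (fun w j hw hj hwj => ?_)
  have hwc : IsCorner w := fun k => (hw k).elim (fun h => h ▸ hy k) (fun h => h ▸ hz k)
  by_cases hji : i = j
  · subst hji
    rw [dirEdge_update]; exact Parallel.refl _
  · have h1 := parallel_of_square
      (C.face_mem Φ (faceAt ![i, j] (pair_injective hji) w) hΦ) (hwc j) (hz j)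
    simp only [Function.comp_apply, faceAt_pair_map hji hwc] at h1
    convert h1 using 1
    · ext t
      simp only [dirEdge]
      congr 1
      rw [Function.update_comm hji, Function.update_eq_self]
    · ext t
      simp only [dirEdge]
      rw [Function.update_comm hji]

theorem dirEdge_parallel_edge {n : ℕ} {Φ : Cube n → X} (hΦ : Φ ∈ C.cubes n) (i : Fin n)
    {y : Cube n} (hy : IsCorner y) : C.Parallel (dirEdge Φ i y) (edge Φ i) :=
  dirEdge_parallel hΦ i hy (isCorner_corner n)

theorem edge_comp_parallel {m n : ℕ} {Φ : Cube n → X} (hΦ : Φ ∈ C.cubes n) (g : FaceMap m n)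
    (i : Fin m) :
    C.Parallel (edge (Φ ∘ g.map) i) (CubeCx.revIf (g.sign (g.inj i)) (edge Φ (g.inj i))) := by
  rw [edge_eq_dirEdge, dirEdge_comp]
  exact (dirEdge_parallel_edge hΦ _ (g.isCorner_map (isCorner_corner m))).revIf _

/-- The direction `i` of the cube `Φ` is dual to the hyperplane of `e`. -/
def Dual (C : CubeComplex X) (e : Cube 1 → X) {n : ℕ} (Φ : Cube n → X) (i : Fin n) : Prop :=
  C.SameHyperplane e (edge Φ i)

theorem dual_comp_iff {e : Cube 1 → X} {m n : ℕ} {Φ : Cube n → X} (hΦ : Φ ∈ C.cubes n)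
    (g : FaceMap m n) (i : Fin m) : C.Dual e (Φ ∘ g.map) i ↔ C.Dual e Φ (g.inj i) := by
  rw [Dual, (edge_comp_parallel hΦ g i).sameHyperplane_iff, sameHyperplane_revIf_iff, Dual]

theorem dual_comp_iff' {e : Cube 1 → X} {m n : ℕ} {Φ : Cube n → X} (hΦ : Φ ∈ C.cubes n)
    (g : FaceMap m n) {i : Fin m} {j : Fin n} (h : g.inj i = j) :
    C.Dual e (Φ ∘ g.map) i ↔ C.Dual e Φ j := by rw [dual_comp_iff hΦ, h]

theorem dual_self {e f : Cube 1 → X} (i : Fin 1) : C.Dual e f i ↔ C.SameHyperplane e f := by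
  rw [Dual, edge_self]

theorem dual_dirEdge {e : Cube 1 → X} {n : ℕ} {Φ : Cube n → X} (hΦ : Φ ∈ C.cubes n) (i : Fin n)
    {y : Cube n} (hy : IsCorner y) :
    C.SameHyperplane e (dirEdge Φ i y) ↔ C.Dual e Φ i :=
  (dirEdge_parallel_edge hΦ i hy).sameHyperplane_iff

/-- Without self-intersections, at most one direction of a cube is dual to a hyperplane. -/
theorem IsSpecial.dual_unique (hC : C.IsSpecial) {e : Cube 1 → X} (he : e ∈ C.cubes 1) {n : ℕ}
    {Φ : Cube n → X} (hΦ : Φ ∈ C.cubes n) {i j : Fin n} (hi : C.Dual e Φ i) (hj : C.Dual e Φ j) :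
    i = j := by
  by_contra h
  let g := faceAt ![i, j] (pair_injective h) (corner n)
  refine hC.no_self_intersection e he ⟨Φ ∘ g.map, C.face_mem Φ g hΦ, ?_, ?_⟩
  · exact (dual_comp_iff' hΦ g (by simp [g, faceAt_inj])).2 hi
  · exact (dual_comp_iff' hΦ g (by simp [g, faceAt_inj])).2 hj

/-! ### Points of a cube complex and points of its hyperplanes -/

/-- If the interiors of two cubes meet, the second cube is obtained from the first one by a symmetry
that matches the parameters of the common point. -/
theorem eq_comp_of_meet {m n : ℕ} {Φ : Cube m → X} {Ψ : Cube n → X} (hΦ : Φ ∈ C.cubes m)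
    (hΨ : Ψ ∈ C.cubes n) {x : Cube m} {y : Cube n} (hx : x ∈ openCube m) (hy : y ∈ openCube n)
    (h : Φ x = Ψ y) : m = n ∧ ∃ g : FaceMap n m, Ψ = Φ ∘ g.map ∧ g.map y = x := by
  obtain ⟨rfl, g, rfl⟩ := C.eq_of_meet Φ Ψ x y hΦ hΨ hx hy h
  exact ⟨rfl, g, rfl, C.injOn _ hΦ (g.map_mem_openCube hy) hx h.symm⟩

/-- If two cubes share a point, they share the face in whose interior it lies. -/
theorem common_face {m n : ℕ} {Φ : Cube m → X} {Ψ : Cube n → X} (hΦ : Φ ∈ C.cubes m)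
    (hΨ : Ψ ∈ C.cubes n) {x : Cube m} {y : Cube n} (h : Φ x = Ψ y) :
    ∃ (k : ℕ) (a : FaceMap k m) (b : FaceMap k n) (z : Cube k), z ∈ openCube k ∧
      Φ ∘ a.map = Ψ ∘ b.map ∧ a.map z = x ∧ b.map z = y := by
  obtain ⟨k, a, z, hz, rfl⟩ := exists_carrier x
  obtain ⟨l, b, w, hw, rfl⟩ := exists_carrier y
  obtain ⟨rfl, g, hg, hgw⟩ := eq_comp_of_meet (Φ := Φ ∘ a.map) (Ψ := Ψ ∘ b.map)
    (C.face_mem _ _ hΦ) (C.face_mem _ _ hΨ) hz hw h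
  refine ⟨k, a.comp g, b, w, hw, ?_, ?_, rfl⟩
  · rw [hg, FaceMap.comp_map]; rfl
  · rw [FaceMap.comp_map, Function.comp_apply, hgw]

theorem continuous_cube {n : ℕ} {Φ : Cube n → X} (hΦ : Φ ∈ C.cubes n) : Continuous Φ :=
  continuous_iff_isClosed.2 fun s hs => (C.isClosed_iff s).1 hs n Φ hΦ

/-- A point common to two cubes and interior in a dual direction of one is so for the other. -/
theorem exists_dual_of_eq {e : Cube 1 → X} {m n : ℕ} {Φ : Cube m → X} {Ψ : Cube n → X}
    (hΦ : Φ ∈ C.cubes m) (hΨ : Ψ ∈ C.cubes n) {x : Cube m} {y : Cube n} (h : Φ x = Ψ y)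
    {i : Fin n} (hi : C.Dual e Ψ i) (hy : IsInner (y i)) :
    ∃ j, C.Dual e Φ j ∧ IsInner (x j) ∧ ∃ s, x j = flip s (y i) := by
  obtain ⟨k, a, b, z, hz, hab, rfl, rfl⟩ := common_face hΦ hΨ h
  obtain ⟨l, rfl, hl⟩ := b.exists_inj_of_isInner hy
  refine ⟨a.inj l, ?_, ?_, ?_⟩
  · rwa [← dual_comp_iff hΦ, hab, dual_comp_iff hΨ]
  · rw [map_inj, isInner_flip]; exact hl
  · rw [map_inj, map_inj]
    exact ⟨xor (a.sign (a.inj l)) (b.sign (b.inj l)), by rw [flip_xor, flip_flip]⟩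

theorem mem_hyperplane_iff {e : Cube 1 → X} {n : ℕ} {Φ : Cube n → X} (hΦ : Φ ∈ C.cubes n)
    {x : Cube n} : Φ x ∈ C.hyperplane e ↔ ∃ i, C.Dual e Φ i ∧ x i = mid := by
  constructor
  · rintro ⟨m, Ψ, i, y, hΨ, hi, hy, h⟩
    obtain ⟨j, hj, -, s, hs⟩ := exists_dual_of_eq hΦ hΨ h.symm hi (hy ▸ isInner_mid)
    exact ⟨j, hj, by rw [hs, hy, flip_mid]⟩
  · rintro ⟨i, hi, hx⟩
    exact ⟨n, Φ, i, x, hΦ, hi, hx, rfl⟩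

theorem range_meets_iff {e : Cube 1 → X} {n : ℕ} {Φ : Cube n → X} (hΦ : Φ ∈ C.cubes n) :
    (Set.range Φ ∩ C.hyperplane e).Nonempty ↔ ∃ i, C.Dual e Φ i := by
  constructor
  · rintro ⟨_, ⟨x, rfl⟩, h⟩
    obtain ⟨i, hi, -⟩ := (mem_hyperplane_iff hΦ).1 h
    exact ⟨i, hi⟩
  · rintro ⟨i, hi⟩
    exact ⟨Φ (fun _ => mid), ⟨_, rfl⟩, (mem_hyperplane_iff hΦ).2 ⟨i, hi, rfl⟩⟩

theorem disjoint_iff {e : Cube 1 → X} {n : ℕ} {Φ : Cube n → X} (hΦ : Φ ∈ C.cubes n) :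
    Disjoint (Set.range Φ) (C.hyperplane e) ↔ ∀ i, ¬ C.Dual e Φ i := by
  rw [Set.disjoint_iff_inter_eq_empty, ← Set.not_nonempty_iff_eq_empty, range_meets_iff hΦ,
    not_exists]

/-! ### The two sides of a separating hyperplane -/

/-- The relation between vertices that is generated by being joined by an edge that is not dual to
the hyperplane of `e`. -/
def SideRel (C : CubeComplex X) (e : Cube 1 → X) : X → X → Prop :=
  Relation.EqvGen fun v w =>
    ∃ f ∈ C.cubes 1, ¬ C.SameHyperplane e f ∧ f (corner 1) = v ∧ f (fun _ => right) = w

theorem SideRel.refl (e : Cube 1 → X) (v : X) : C.SideRel e v v := Relation.EqvGen.refl v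

theorem SideRel.symm {e : Cube 1 → X} {v w : X} (h : C.SideRel e v w) : C.SideRel e w v :=
  Relation.EqvGen.symm _ _ h

theorem SideRel.trans {e : Cube 1 → X} {u v w : X} (h : C.SideRel e u v)
    (h' : C.SideRel e v w) : C.SideRel e u w := Relation.EqvGen.trans _ _ _ h h'

/-- Corners of a cube that agree in the direction dual to a hyperplane are on the same side. -/
theorem sideRel_corners {e : Cube 1 → X} {n : ℕ} {Φ : Cube n → X} (hΦ : Φ ∈ C.cubes n)
    {y z : Cube n} (hy : IsCorner y) (hz : IsCorner z) (h : ∀ j, y j ≠ z j → ¬ C.Dual e Φ j) :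
    C.SideRel e (Φ y) (Φ z) := by
  refine coordinate_walk (fun y z => C.SideRel e (Φ y) (Φ z))
    (fun x => SideRel.refl _ _) (fun x y z h h' => h.trans h') y z (fun w j hw hj hwj => ?_)
  have hwc : IsCorner w := fun k => (hw k).elim (fun h => h ▸ hy k) (fun h => h ▸ hz k)
  have := dirEdge_relate (r := C.SideRel e) ⟨SideRel.refl e, SideRel.symm, SideRel.trans⟩
    (Φ := Φ) (i := j) (w := w) (Relation.EqvGen.rel _ _
      ⟨_, dirEdge_mem hΦ j hwc, fun h' => h j hj ((dual_dirEdge hΦ j hwc).1 h'), rfl, rfl⟩)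
    (hwc j) (hz j)
  rwa [Function.update_eq_self] at this

/-- In a connected cube complex, an equivalence relation that relates the corners of every cube
relates all vertices. -/
theorem vertices_related [ConnectedSpace X] {r : X → X → Prop} (hr : Equivalence r)
    (h : ∀ {n : ℕ} {Φ : Cube n → X}, Φ ∈ C.cubes n → ∀ {y z : Cube n}, IsCorner y → IsCorner z →
      r (Φ y) (Φ z)) {m n : ℕ} {Φ : Cube m → X} {Ψ : Cube n → X} (hΦ : Φ ∈ C.cubes m)
    (hΨ : Ψ ∈ C.cubes n) : r (Φ (corner m)) (Ψ (corner n)) := by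
  have meet : ∀ {k l : ℕ} {Φ : Cube k → X} {Ψ : Cube l → X}, Φ ∈ C.cubes k → Ψ ∈ C.cubes l →
      ∀ {x y}, Φ x = Ψ y → r (Φ (corner k)) (Ψ (corner l)) := by
    intro k l Φ Ψ hΦ hΨ x y hxy
    obtain ⟨j, a, b, z, -, hab, -, -⟩ := common_face hΦ hΨ hxy
    refine hr.trans (h hΦ (isCorner_corner k) (a.isCorner_map (isCorner_corner j))) ?_
    rw [show Φ (a.map (corner j)) = Ψ (b.map (corner j)) from congrFun hab _]
    exact h hΨ (b.isCorner_map (isCorner_corner j)) (isCorner_corner l)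
  let T : Set X := {p | ∃ (k : ℕ) (Θ : Cube k → X) (x : Cube k), Θ ∈ C.cubes k ∧ Θ x = p ∧
    r (Φ (corner m)) (Θ (corner k))}
  have mem : ∀ {k : ℕ} {Θ : Cube k → X}, Θ ∈ C.cubes k → ∀ x,
      (Θ x ∈ T ↔ r (Φ (corner m)) (Θ (corner k))) := by
    intro k Θ hΘ x
    constructor
    · rintro ⟨l, Ξ, y, hΞ, hy, hr'⟩
      exact hr.trans hr' (meet hΞ hΘ hy)
    · intro h'
      exact ⟨k, Θ, x, hΘ, rfl, h'⟩
  have hT : IsClopen T := by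
    constructor
    · rw [C.isClosed_iff]
      intro k Θ hΘ
      by_cases h' : r (Φ (corner m)) (Θ (corner k))
      · rw [show Θ ⁻¹' T = univ from eq_univ_of_forall fun x => (mem hΘ x).2 h']
        exact isClosed_univ
      · rw [show Θ ⁻¹' T = ∅ from eq_empty_of_forall_notMem fun x hx => h' ((mem hΘ x).1 hx)]
        exact isClosed_empty
    · rw [← isClosed_compl_iff, C.isClosed_iff]
      intro k Θ hΘ
      by_cases h' : r (Φ (corner m)) (Θ (corner k))
      · rw [show Θ ⁻¹' Tᶜ = ∅ from eq_empty_of_forall_notMem fun x hx => hx ((mem hΘ x).2 h')]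
        exact isClosed_empty
      · rw [show Θ ⁻¹' Tᶜ = univ from eq_univ_of_forall fun x hx => h' ((mem hΘ x).1 hx)]
        exact isClosed_univ
  have := hT.eq_univ ⟨_, (mem hΦ (corner m)).2 (hr.refl _)⟩
  exact (mem hΨ (corner n)).1 (this ▸ mem_univ _)

theorem isPreconnected_interval {s : Set ℝ} (hs : s.OrdConnected) :
    IsPreconnected {t : Interval | (t : ℝ) ∈ s} := by
  rw [← IsInducing.subtypeVal.isPreconnected_image]
  rw [show Subtype.val '' {t : Interval | (t : ℝ) ∈ s} = Set.Icc (-1) 1 ∩ s from by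
    ext r; constructor
    · rintro ⟨t, ht, rfl⟩; exact ⟨t.2, ht⟩
    · rintro ⟨h1, h2⟩; exact ⟨⟨r, h1⟩, h2, rfl⟩]
  exact (Set.ordConnected_Icc.inter hs).isPreconnected

instance : PreconnectedSpace Interval :=
  ⟨by simpa using isPreconnected_interval ordConnected_univ⟩

/-- The two points lie in a connected subset of `S`. -/
def ConnectedIn (S : Set X) (p q : X) : Prop := ∃ t ⊆ S, p ∈ t ∧ q ∈ t ∧ IsPreconnected t

theorem ConnectedIn.trans {S : Set X} {p q r : X} (h : ConnectedIn S p q) (h' : ConnectedIn S q r) :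
    ConnectedIn S p r := by
  obtain ⟨t, ht, hp, hq, htc⟩ := h
  obtain ⟨t', ht', hq', hr, htc'⟩ := h'
  exact ⟨t ∪ t', union_subset ht ht', Or.inl hp, Or.inr hr, htc.union q hq hq' htc'⟩

theorem ConnectedIn.symm {S : Set X} {p q : X} (h : ConnectedIn S p q) : ConnectedIn S q p := by
  obtain ⟨t, ht, hp, hq, htc⟩ := h
  exact ⟨t, ht, hq, hp, htc⟩

/-- A point outside the hyperplane is joined to the corner on the same side of the midcube: the
points of the cube whose coordinates have the same signs form a connected set. -/
theorem exists_joinedIn_corner {e : Cube 1 → X} {n : ℕ} {Φ : Cube n → X} (hΦ : Φ ∈ C.cubes n)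
    {x : Cube n} (hx : Φ x ∉ C.hyperplane e) :
    ∃ y, IsCorner y ∧ ConnectedIn (C.hyperplane e)ᶜ (Φ x) (Φ y) := by
  classical
  have hx' : ∀ i, C.Dual e Φ i → x i ≠ mid := fun i hi h =>
    hx ((mem_hyperplane_iff hΦ).2 ⟨i, hi, h⟩)
  let s : Fin n → Set ℝ := fun i =>
    if (x i : ℝ) = 0 then univ else if 0 < (x i : ℝ) then Ioi 0 else Iio 0
  have hs : ∀ i, (s i).OrdConnected := by
    intro i
    simp only [s]
    split_ifs
    · exact ordConnected_univ
    · exact ordConnected_Ioi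
    · exact ordConnected_Iio
  let y : Cube n := fun i => if 0 < (x i : ℝ) then right else left
  refine ⟨y, fun i => ?_, Φ '' Set.pi univ (fun i => {t : Interval | (t : ℝ) ∈ s i}), ?_, ?_, ?_, ?_⟩
  · simp only [y]; split_ifs
    · exact isEnd_right
    · exact isEnd_left
  · rintro _ ⟨z, hz, rfl⟩ h
    obtain ⟨i, hi, hzi⟩ := (mem_hyperplane_iff hΦ).1 h
    have h0 : (x i : ℝ) ≠ 0 := fun h => hx' i hi (Subtype.ext h)
    have := hz i trivial
    simp only [s, h0, if_false, mem_ofPred_eq, hzi, mid] at this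
    split_ifs at this <;> simp at this
  · refine mem_image_of_mem _ fun i _ => ?_
    simp only [s, mem_ofPred_eq]
    split_ifs with h1 h2
    · trivial
    · exact h2
    · exact lt_of_le_of_ne (not_lt.1 h2) h1
  · refine mem_image_of_mem _ fun i _ => ?_
    simp only [s, y, mem_ofPred_eq]
    split_ifs with h1 h2 h3
    · trivial
    · trivial
    · simp [right]
    · simp [left]
  · exact (isPreconnected_univ_pi fun i => isPreconnected_interval (hs i)).image _
      (continuous_cube hΦ).continuousOn

theorem SideRel.joinedIn {e : Cube 1 → X} {v w : X} (h : C.SideRel e v w) :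
    v = w ∨ ConnectedIn (C.hyperplane e)ᶜ v w := by
  induction h with
  | rel v w h =>
    obtain ⟨f, hf, hef, rfl, rfl⟩ := h
    refine Or.inr ⟨range f, ?_, ⟨_, rfl⟩, ⟨_, rfl⟩, isPreconnected_range (continuous_cube hf)⟩
    rw [Set.subset_compl_iff_disjoint_right, disjoint_iff hf]
    intro i
    rwa [dual_self]
  | refl v => exact Or.inl rfl
  | symm v w _ ih => exact ih.imp Eq.symm ConnectedIn.symm
  | trans u v w _ _ ih ih' =>
    rcases ih with rfl | ih
    · exact ih'
    · rcases ih' with rfl | ih'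
      · exact Or.inr ih
      · exact Or.inr (ih.trans ih')

/-- The initial vertices of parallel edges dual to a hyperplane are on the same side of it, and so
are their terminal vertices. -/
theorem Parallel.sideRel (hC : C.IsSpecial) {e : Cube 1 → X} (he : e ∈ C.cubes 1)
    {a b : Cube 1 → X} (h : C.Parallel a b) (ha : C.SameHyperplane e a) :
    C.SideRel e (a (corner 1)) (b (corner 1)) ∧
      C.SideRel e (a fun _ => right) (b fun _ => right) := by
  induction h with
  | rel a b h =>
    obtain ⟨Φ, hΦ, rfl, rfl⟩ := h
    have h0 : C.Dual e Φ 0 := by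
      rw [← dual_dirEdge hΦ 0 (isCorner_corner 2)]
      have : dirEdge Φ 0 (corner 2) = fun t => Φ ![t 0, left] := by
        ext t
        simp only [dirEdge]
        congr 1
        ext j
        fin_cases j <;> rfl
      rwa [this]
    have h1 : ¬ C.Dual e Φ 1 := fun h => absurd (hC.dual_unique he hΦ h0 h) (by simp)
    have key : ∀ s, IsEnd s → C.SideRel e (Φ ![s, left]) (Φ ![s, right]) := by
      intro s hs
      refine sideRel_corners hΦ ?_ ?_ ?_
      · intro i; fin_cases i
        · exact hs
        · exact isEnd_left
      · intro i; fin_cases i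
        · exact hs
        · exact isEnd_right
      · intro j; fin_cases j
        · simp
        · intro _; exact h1
    exact ⟨key left isEnd_left, key right isEnd_right⟩
  | refl a => exact ⟨SideRel.refl _ _, SideRel.refl _ _⟩
  | symm a b h ih =>
    have := ih (ha.trans (Parallel.symm h).sameHyperplane)
    exact ⟨this.1.symm, this.2.symm⟩
  | trans a b c h h' ih ih' =>
    have h1 := ih ha
    have h2 := ih' (ha.trans (Parallel.sameHyperplane h))
    exact ⟨h1.1.trans h2.1, h1.2.trans h2.2⟩

/-- The two ends of an edge that is dual to a separating hyperplane are on different sides. -/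
theorem IsSpecial.not_sideRel [ConnectedSpace X] (hC : C.IsSpecial) {e : Cube 1 → X}
    (he : e ∈ C.cubes 1) (hsep : IsSeparating (C.hyperplane e)) {f : Cube 1 → X}
    (hf : C.SameHyperplane e f) : ¬ C.SideRel e (f (corner 1)) (f fun _ => right) := by
  intro hside
  have ends : ∀ (s : Bool) (g : Cube 1 → X),
      C.SideRel e (revIf s g (corner 1)) (revIf s g fun _ => right) ↔
        C.SideRel e (g (corner 1)) (g fun _ => right) := by
    intro s g
    cases s
    · rw [revIf_false]
    · have h1 : CubeCx.revIf true g (corner 1) = g (fun _ => right) := by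
        simp [CubeCx.revIf, corner]
      have h2 : CubeCx.revIf true g (fun _ => right) = g (corner 1) := by
        simp [CubeCx.revIf]; rfl
      rw [h1, h2]
      exact ⟨SideRel.symm, SideRel.symm⟩
  have all : ∀ g, C.SameHyperplane e g → C.SideRel e (g (corner 1)) (g fun _ => right) := by
    intro g hg
    obtain ⟨s, hs⟩ := sameHyperplane_iff.1 (hf.symm.trans hg)
    rw [← ends s]
    have := hs.sideRel hC he hf
    exact this.1.symm.trans (hside.trans this.2)
  have eqv : Equivalence (C.SideRel e) := ⟨SideRel.refl e, SideRel.symm, SideRel.trans⟩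
  have corners : ∀ {n : ℕ} {Φ : Cube n → X}, Φ ∈ C.cubes n → ∀ {y z : Cube n}, IsCorner y →
      IsCorner z → C.SideRel e (Φ y) (Φ z) := by
    intro n Φ hΦ y z hy hz
    refine coordinate_walk (fun y z => C.SideRel e (Φ y) (Φ z)) (fun x => SideRel.refl _ _)
      (fun x y z h h' => h.trans h') y z (fun w j hw hj hwj => ?_)
    have hwc : IsCorner w := fun k => (hw k).elim (fun h => h ▸ hy k) (fun h => h ▸ hz k)
    have : C.SideRel e (dirEdge Φ j w (corner 1)) (dirEdge Φ j w fun _ => right) := by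
      by_cases hd : C.SameHyperplane e (dirEdge Φ j w)
      · exact all _ hd
      · exact Relation.EqvGen.rel _ _ ⟨_, dirEdge_mem hΦ j hwc, hd, rfl, rfl⟩
    have := dirEdge_relate eqv this (hwc j) (hz j)
    rwa [Function.update_eq_self] at this
  have hpre : IsPreconnected (C.hyperplane e)ᶜ := by
    refine isPreconnected_of_forall_pair fun p hp q hq => ?_
    obtain ⟨m, Φ, x, hΦ, -, rfl⟩ := C.cover p
    obtain ⟨n, Ψ, y, hΨ, -, rfl⟩ := C.cover q
    obtain ⟨x', hx', hj⟩ := exists_joinedIn_corner hΦ hp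
    obtain ⟨y', hy', hj'⟩ := exists_joinedIn_corner hΨ hq
    have h1 : C.SideRel e (Φ x') (Ψ y') := (corners hΦ hx' (isCorner_corner m)).trans
      ((vertices_related eqv corners hΦ hΨ).trans (corners hΨ (isCorner_corner n) hy'))
    rcases h1.joinedIn with h2 | h2
    · rw [h2] at hj
      exact hj.trans hj'.symm
    · exact (hj.trans h2).trans hj'.symm
  have : PreconnectedSpace ((C.hyperplane e)ᶜ : Set X) := isPreconnected_iff_preconnectedSpace.1 hpre
  have hsub : Subsingleton (ConnectedComponents ((C.hyperplane e)ᶜ : Set X)) := inferInstance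
  exact not_subsingleton_iff_nontrivial.2 hsep hsub

end CubeComplex

/-! ### Edges and facets as face maps -/

theorem edge_eq_comp {n : ℕ} (i : Fin n) : ∃ g : FaceMap 1 n, g.inj 0 = i ∧
    ∀ {X : Type u} (Φ : Cube n → X), edge Φ i = Φ ∘ g.map := by
  have hσ : Function.Injective (fun _ : Fin 1 => i) := fun a b _ => Subsingleton.elim a b
  refine ⟨faceAt (fun _ : Fin 1 => i) hσ (corner n), by rw [faceAt_inj], fun Φ => ?_⟩
  ext t
  simp only [edge, Function.comp_apply]
  congr 1
  refine (faceAt_map _ (fun l => ?_) (fun j hj => ⟨?_, isCorner_corner n j⟩)).symm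
  · simp [Subsingleton.elim l 0]
  · exact Function.update_of_ne (fun h => hj 0 h.symm) _ _

theorem corner_eq_map (n : ℕ) : ∃ g : FaceMap 0 n, ∀ z, g.map z = corner n :=
  ⟨faceAt Fin.elim0 (fun i => i.elim0) (corner n), fun _ =>
    faceAt_map _ (fun i => i.elim0) (fun j _ => ⟨rfl, isCorner_corner n j⟩)⟩

/-- The facet `{x 0 = -1}` of the cube `Ω`. -/
def leftFacet {X : Type u} {n : ℕ} (Ω : Cube (n + 1) → X) : Cube n → X :=
  fun w => Ω (Matrix.vecCons left w)

/-- The facet `{x 0 = 1}` of the cube `Ω`. -/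
def rightFacet {X : Type u} {n : ℕ} (Ω : Cube (n + 1) → X) : Cube n → X :=
  fun w => Ω (Matrix.vecCons right w)

theorem leftFacet_eq {X : Type u} {n : ℕ} (Ω : Cube (n + 1) → X) :
    leftFacet Ω = Ω ∘ (facet true n).map := by
  ext w; simp [leftFacet, facet_map]

theorem rightFacet_eq {X : Type u} {n : ℕ} (Ω : Cube (n + 1) → X) :
    rightFacet Ω = Ω ∘ (facet false n).map := by
  ext w; simp [rightFacet, facet_map]

theorem leftFacet_comp {X : Type u} {m n : ℕ} (Ω : Cube (n + 1) → X) (g : FaceMap m n) :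
    leftFacet (Ω ∘ (consMap false g).map) = leftFacet Ω ∘ g.map := by
  ext w; simp [leftFacet, consMap_map]

theorem rightFacet_comp {X : Type u} {m n : ℕ} (Ω : Cube (n + 1) → X) (g : FaceMap m n) :
    rightFacet (Ω ∘ (consMap false g).map) = rightFacet Ω ∘ g.map := by
  ext w; simp [rightFacet, consMap_map]

theorem leftFacet_reflect {X : Type u} {n : ℕ} (Ω : Cube (n + 1) → X) :
    leftFacet (Ω ∘ (consMap true (idMap n)).map) = rightFacet Ω := by
  ext w; simp [leftFacet, rightFacet, consMap_map, idMap_map]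

theorem rightFacet_reflect {X : Type u} {n : ℕ} (Ω : Cube (n + 1) → X) :
    rightFacet (Ω ∘ (consMap true (idMap n)).map) = leftFacet Ω := by
  ext w; simp [leftFacet, rightFacet, consMap_map, idMap_map]

theorem reflect_reflect {X : Type u} {n : ℕ} (Ω : Cube (n + 1) → X) :
    (Ω ∘ (consMap true (idMap n)).map) ∘ (consMap true (idMap n)).map = Ω := by
  ext x
  rw [← vecCons_head_tail x]
  simp [consMap_map, idMap_map]

theorem leftFacet_corner {X : Type u} {n : ℕ} (Ω : Cube (n + 1) → X) :
    leftFacet Ω (corner n) = Ω (corner (n + 1)) := by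
  rw [leftFacet, vecCons_left_corner]

theorem edge_succ {X : Type u} {n : ℕ} (Ω : Cube (n + 1) → X) (i : Fin n) :
    edge Ω i.succ = edge (leftFacet Ω) i := by
  ext t
  simp only [edge, leftFacet]
  rw [← vecCons_left_corner, update_vecCons_succ]

theorem edge_zero_apply {X : Type u} {n : ℕ} (Ω : Cube (n + 1) → X) (t : Cube 1) :
    edge Ω 0 t = Ω (Matrix.vecCons (t 0) (corner n)) := by
  simp only [edge]
  rw [← vecCons_left_corner, update_vecCons_zero]

namespace CubeComplex

variable {X : Type u} [TopologicalSpace X] {C : CubeComplex X}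

/-! ### Uniqueness of dual edges and opposite faces -/

theorem leftFacet_mem {n : ℕ} {Ω : Cube (n + 1) → X} (h : Ω ∈ C.cubes (n + 1)) :
    leftFacet Ω ∈ C.cubes n := by
  rw [leftFacet_eq]; exact C.face_mem _ _ h

theorem rightFacet_mem {n : ℕ} {Ω : Cube (n + 1) → X} (h : Ω ∈ C.cubes (n + 1)) :
    rightFacet Ω ∈ C.cubes n := by
  rw [rightFacet_eq]; exact C.face_mem _ _ h

theorem dual_leftFacet_iff {e : Cube 1 → X} {n : ℕ} {Ω : Cube (n + 1) → X}
    (h : Ω ∈ C.cubes (n + 1)) (i : Fin n) : C.Dual e (leftFacet Ω) i ↔ C.Dual e Ω i.succ := by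
  rw [leftFacet_eq, dual_comp_iff h, facet_inj]

theorem spanSquare_edges {n : ℕ} {Φ : Cube n → X} (hΦ : Φ ∈ C.cubes n) {i j : Fin n}
    (hij : i ≠ j) : C.SpanSquare (edge Φ i) (edge Φ j) := by
  have hm := faceAt_pair_map hij (isCorner_corner n)
  have hcons : ∀ t : Interval, Function.update (corner 2) 0 t = ![t, left] ∧
      Function.update (corner 2) 1 t = ![left, t] := by
    intro t
    constructor <;> ext j <;> fin_cases j <;> rfl
  have hl : ∀ j, Function.update (corner n) j left = corner n := fun j => by
    rw [Function.update_eq_self_iff]; rfl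
  refine ⟨_, C.face_mem Φ (faceAt ![i, j] (pair_injective hij) (corner n)) hΦ, ?_, ?_⟩
  · ext t
    simp only [edge, Function.comp_apply]
    rw [(hcons (t 0)).1, hm, Function.update_comm hij, hl]
  · ext t
    simp only [edge, Function.comp_apply]
    rw [(hcons (t 0)).2, hm, hl]

theorem SpanSquare.symm {f g : Cube 1 → X} (h : C.SpanSquare f g) : C.SpanSquare g f := by
  obtain ⟨Φ, hΦ, rfl, rfl⟩ := h
  exact spanSquare_edges hΦ (by simp)

/-- In a special cube complex, the edge `e` is dual to a hyperplane that separates the two ends of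
each of its dual edges. -/
structure SeparatingEdge (C : CubeComplex X) (e : Cube 1 → X) : Prop where
  special : C.IsSpecial
  mem : e ∈ C.cubes 1
  ends : ∀ {f : Cube 1 → X}, C.SameHyperplane e f →
    ¬ C.SideRel e (f (corner 1)) (f fun _ => right)

namespace SeparatingEdge

variable {e : Cube 1 → X}

theorem dual_unique (he : C.SeparatingEdge e) {n : ℕ} {Φ : Cube n → X} (hΦ : Φ ∈ C.cubes n)
    {i j : Fin n} (hi : C.Dual e Φ i) (hj : C.Dual e Φ j) : i = j :=
  he.special.dual_unique he.mem hΦ hi hj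

/-- Dual edges that start on the same side are parallel. -/
theorem parallel_of_sideRel (he : C.SeparatingEdge e) {k l : Cube 1 → X}
    (hk : C.SameHyperplane e k) (hl : C.SameHyperplane e l)
    (h : C.SideRel e (k (corner 1)) (l (corner 1))) : C.Parallel k l := by
  rcases hk.symm.trans hl with h' | h'
  · exact h'
  · have h1 := (Parallel.sideRel he.special he.mem h' hk).1
    have h2 : reverse l (corner 1) = l fun _ => right := by simp [reverse, corner]
    rw [h2] at h1
    exact absurd (h.symm.trans h1) (he.ends hl)

/-- There is at most one dual edge that starts at a given vertex: two of them are parallel, as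
they start on the same side, and neither osculate nor span a square. -/
theorem edge_unique (he : C.SeparatingEdge e) {k l : Cube 1 → X} (hkm : k ∈ C.cubes 1)
    (hlm : l ∈ C.cubes 1) (hk : C.SameHyperplane e k) (hl : C.SameHyperplane e l)
    (h : k (corner 1) = l (corner 1)) : k = l := by
  by_contra hne
  refine he.special.no_direct_self_osculation k hkm l hlm
    (he.parallel_of_sideRel hk hl (h ▸ SideRel.refl _ _)) ⟨hne, h, ?_⟩
  rintro ⟨Φ, hΦ, rfl, rfl⟩
  exact absurd (he.dual_unique hΦ hk hl) (by simp)

theorem not_dual_leftFacet (he : C.SeparatingEdge e) {n : ℕ} {Ω : Cube (n + 1) → X}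
    (h : Ω ∈ C.cubes (n + 1)) (h0 : C.Dual e Ω 0) (i : Fin n) : ¬ C.Dual e (leftFacet Ω) i := by
  rw [dual_leftFacet_iff h]
  exact fun h' => (Fin.succ_ne_zero i).symm (he.dual_unique h h0 h')

end SeparatingEdge

theorem reflect_mem {n : ℕ} {Ω : Cube (n + 1) → X} (h : Ω ∈ C.cubes (n + 1)) :
    Ω ∘ (consMap true (idMap n)).map ∈ C.cubes (n + 1) := C.face_mem _ _ h

theorem dual_consMap_iff {e : Cube 1 → X} {m n : ℕ} {Ω : Cube (n + 1) → X}
    (h : Ω ∈ C.cubes (n + 1)) (s : Bool) (g : FaceMap m n) :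
    C.Dual e (Ω ∘ (consMap s g).map) 0 ↔ C.Dual e Ω 0 :=
  dual_comp_iff' h _ (consMap_inj_zero s g)

/-- `Φ` and `Ψ` are opposite facets of a cube in whose midcube between them the hyperplane of `e`
lies. -/
def Opp (C : CubeComplex X) (e : Cube 1 → X) {m : ℕ} (Φ Ψ : Cube m → X) : Prop :=
  ∃ Ω ∈ C.cubes (m + 1), C.Dual e Ω 0 ∧ leftFacet Ω = Φ ∧ rightFacet Ω = Ψ

namespace Opp

variable {e : Cube 1 → X} {m : ℕ} {Φ Ψ : Cube m → X}

theorem symm (h : C.Opp e Φ Ψ) : C.Opp e Ψ Φ := by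
  obtain ⟨Ω, hΩ, h0, rfl, rfl⟩ := h
  exact ⟨_, reflect_mem hΩ, (dual_consMap_iff hΩ _ _).2 h0, leftFacet_reflect Ω,
    rightFacet_reflect Ω⟩

theorem comp (h : C.Opp e Φ Ψ) {n : ℕ} (g : FaceMap n m) : C.Opp e (Φ ∘ g.map) (Ψ ∘ g.map) := by
  obtain ⟨Ω, hΩ, h0, rfl, rfl⟩ := h
  exact ⟨_, C.face_mem Ω (consMap false g) hΩ, (dual_consMap_iff hΩ _ _).2 h0,
    leftFacet_comp Ω g, rightFacet_comp Ω g⟩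

theorem edge (h : C.Opp e Φ Ψ) (i : Fin m) : C.Opp e (edge Φ i) (CubeCx.edge Ψ i) := by
  obtain ⟨g, -, hg⟩ := edge_eq_comp i
  rw [hg, hg]
  exact h.comp g

theorem left_mem (h : C.Opp e Φ Ψ) : Φ ∈ C.cubes m := by
  obtain ⟨Ω, hΩ, -, rfl, rfl⟩ := h
  exact leftFacet_mem hΩ

theorem right_mem (h : C.Opp e Φ Ψ) : Ψ ∈ C.cubes m := h.symm.left_mem

theorem not_dual_left (he : C.SeparatingEdge e) (h : C.Opp e Φ Ψ) (i : Fin m) :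
    ¬ C.Dual e Φ i := by
  obtain ⟨Ω, hΩ, h0, rfl, rfl⟩ := h
  exact he.not_dual_leftFacet hΩ h0 i

theorem not_dual_right (he : C.SeparatingEdge e) (h : C.Opp e Φ Ψ) (i : Fin m) :
    ¬ C.Dual e Ψ i := h.symm.not_dual_left he i

/-- Opposite facets are on different sides of the hyperplane. -/
theorem not_sideRel (he : C.SeparatingEdge e) (h : C.Opp e Φ Ψ) {y z : Cube m} (hy : IsCorner y)
    (hz : IsCorner z) : ¬ C.SideRel e (Φ y) (Ψ z) := by
  intro hyz
  have h1 : ∀ {x x' : Cube m}, IsCorner x → IsCorner x' → C.SideRel e (Φ x) (Φ x') :=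
    fun hx hx' => sideRel_corners h.left_mem hx hx' fun j _ => h.not_dual_left he j
  have h2 : ∀ {x x' : Cube m}, IsCorner x → IsCorner x' → C.SideRel e (Ψ x) (Ψ x') :=
    fun hx hx' => sideRel_corners h.right_mem hx hx' fun j _ => h.not_dual_right he j
  obtain ⟨Ω, hΩ, h0, rfl, rfl⟩ := h
  have hc := isCorner_corner m
  refine he.ends h0 ?_
  rw [edge_zero_apply, edge_zero_apply]
  exact (h1 hc hy).trans (hyz.trans (h2 hz hc))

theorem ne_corner (he : C.SeparatingEdge e) (h : C.Opp e Φ Ψ) : Φ (corner m) ≠ Ψ (corner m) :=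
  fun h' => h.not_sideRel he (isCorner_corner m) (isCorner_corner m) (h' ▸ SideRel.refl _ _)

theorem parallel {f g : Cube 1 → X} (h : C.Opp e f g) : C.Parallel f g := by
  obtain ⟨Ω, hΩ, -, rfl, rfl⟩ := h
  have h1 := dirEdge_parallel hΩ 1 ((isCorner_corner 2).update 0 isEnd_left)
    ((isCorner_corner 2).update 0 isEnd_right)
  convert h1 using 1
  · ext t
    simp only [leftFacet, dirEdge]
    congr 1
    ext j; fin_cases j <;> rfl
  · ext t
    simp only [rightFacet, dirEdge]
    congr 1
    ext j; fin_cases j <;> rfl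

end Opp

/-- By the link condition, a cube is determined by its first facet and its first edge. -/
theorem IsNPC.eq_of_leftFacet (hC : C.IsNPC) {n : ℕ} {Ω Ω' : Cube (n + 1) → X}
    (h : Ω ∈ C.cubes (n + 1)) (h' : Ω' ∈ C.cubes (n + 1)) (hf : leftFacet Ω = leftFacet Ω')
    (he : CubeCx.edge Ω 0 = CubeCx.edge Ω' 0) : Ω = Ω' := by
  refine hC.determined Ω Ω' h h' ?_ (fun i => ?_)
  · rw [← leftFacet_corner Ω, ← leftFacet_corner Ω', hf]
  · refine Fin.cases he (fun j => ?_) i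
    rw [edge_succ, edge_succ, hf]

namespace SeparatingEdge

variable {e : Cube 1 → X}

theorem eq_of_leftFacet (he : C.SeparatingEdge e) {n : ℕ} {Ω Ω' : Cube (n + 1) → X}
    (h : Ω ∈ C.cubes (n + 1)) (h' : Ω' ∈ C.cubes (n + 1)) (h0 : C.Dual e Ω 0)
    (h0' : C.Dual e Ω' 0) (hf : leftFacet Ω = leftFacet Ω') : Ω = Ω' := by
  refine he.special.npc.eq_of_leftFacet h h' hf
    (he.edge_unique (edge_mem h 0) (edge_mem h' 0) h0 h0' ?_)
  rw [edge_corner, edge_corner, ← leftFacet_corner Ω, ← leftFacet_corner Ω', hf]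

theorem opp_unique (he : C.SeparatingEdge e) {m : ℕ} {Φ Ψ Ψ' : Cube m → X} (h : C.Opp e Φ Ψ)
    (h' : C.Opp e Φ Ψ') : Ψ = Ψ' := by
  obtain ⟨Ω, hΩ, h0, hl, rfl⟩ := h
  obtain ⟨Ω', hΩ', h0', hl', rfl⟩ := h'
  rw [he.eq_of_leftFacet hΩ hΩ' h0 h0' (hl.trans hl'.symm)]

/-- A cube with a dual edge `k` at its corner that spans squares with all its edges there is a facet
of a cube with edge `k`, by flagness of the link. -/
theorem exists_extension (he : C.SeparatingEdge e) {n : ℕ} {Φ : Cube n → X} (hΦ : Φ ∈ C.cubes n)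
    (hd : ∀ i, ¬ C.Dual e Φ i) {k : Cube 1 → X} (hk : k ∈ C.cubes 1)
    (hek : C.SameHyperplane e k) (hkc : k (corner 1) = Φ (corner n))
    (hsq : ∀ i, C.SpanSquare k (edge Φ i)) :
    ∃ Ω ∈ C.cubes (n + 1), C.Dual e Ω 0 ∧ edge Ω 0 = k ∧ leftFacet Ω = Φ := by
  obtain ⟨g, hg⟩ := corner_eq_map n
  have hne : ∀ i, k ≠ edge Φ i := fun i h => hd i (by rw [Dual, ← h]; exact hek)
  have hinj := he.special.npc.distinct_vertices Φ hΦ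
  obtain ⟨Ω, hΩ, hc, hedge⟩ := he.special.npc.flag (Φ ∘ g.map)
    (Matrix.vecCons k (fun i => edge Φ i)) (C.face_mem Φ g hΦ)
    (by
      intro i
      refine Fin.cases ⟨hk, ?_⟩ (fun j => ⟨edge_mem hΦ j, ?_⟩) i
      · simp [hg, hkc]
      · simp [hg, edge_corner])
    (by
      intro a b
      refine Fin.cases ?_ (fun a => ?_) a <;> refine Fin.cases ?_ (fun b => ?_) b
      · simp
      · intro h; exact absurd h (hne b)
      · intro h; exact absurd h.symm (hne a)
      · intro h; exact congrArg Fin.succ (hinj h))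
    (by
      intro a b
      refine Fin.cases ?_ (fun a => ?_) a <;> refine Fin.cases ?_ (fun b => ?_) b
      · simp
      · intro _; exact hsq b
      · intro _; exact (hsq a).symm
      · intro hab
        have hab' : a ≠ b := fun h => hab (by rw [h])
        exact spanSquare_edges hΦ hab')
  have hkΩ : edge Ω 0 = k := hedge 0
  have hc' : Ω (corner (n + 1)) = Φ (corner n) := by rw [hc, Function.comp_apply, hg]
  refine ⟨Ω, hΩ, ?_, hkΩ, ?_⟩
  · rw [Dual, hkΩ]; exact hek
  · refine he.special.npc.determined _ _ (leftFacet_mem hΩ) hΦ (by rw [leftFacet_corner, hc'])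
      (fun i => ?_)
    rw [← edge_succ]; exact hedge i.succ

/-- A cube is opposite to another one if its edges at the corner are opposite to edges. -/
theorem exists_opp (he : C.SeparatingEdge e) {n : ℕ} {Φ : Cube n → X} (hΦ : Φ ∈ C.cubes n)
    {v w : Cube 0 → X} (hv : C.Opp e v w) (hvΦ : v (corner 0) = Φ (corner n))
    {ε : Fin n → Cube 1 → X} (hε : ∀ i, C.Opp e (edge Φ i) (ε i)) :
    ∃ Ψ, C.Opp e Φ Ψ ∧ Ψ (corner n) = w (corner 0) ∧ ∀ i, edge Ψ i = ε i := by
  obtain ⟨k, hk, hk0, rfl, rfl⟩ := hv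
  have hek : C.SameHyperplane e k := (dual_self 0).1 hk0
  have hkc : k (corner 1) = Φ (corner n) := by rw [← hvΦ, leftFacet_corner]
  have hd : ∀ i, ¬ C.Dual e Φ i := fun i hi =>
    (hε i).not_dual_left he 0 ((dual_self 0).2 hi)
  obtain ⟨Ω, hΩ, h0, hΩk, hΩΦ⟩ := he.exists_extension hΦ hd hk hek hkc (fun i => by
    obtain ⟨Θ, hΘ, h0, hl, hr⟩ := hε i
    refine ⟨Θ, hΘ, he.edge_unique (edge_mem hΘ 0) hk h0 hek ?_, ?_⟩
    · rw [edge_corner, ← leftFacet_corner Θ, hl, edge_corner, hkc]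
    · rw [← hl, show (1 : Fin 2) = Fin.succ 0 from rfl, edge_succ, edge_self])
  have hopp : C.Opp e Φ (rightFacet Ω) := ⟨Ω, hΩ, h0, hΩΦ, rfl⟩
  refine ⟨rightFacet Ω, hopp, ?_, fun i => he.opp_unique (hopp.edge i) (hε i)⟩
  have := congrFun hΩk (fun _ => right)
  rw [edge_zero_apply] at this
  simp only [rightFacet]
  rw [this]
  congr 1
  ext i; rw [Subsingleton.elim i 0]; rfl

end SeparatingEdge

/-! ### Segments across the hyperplane -/

/-- The points `p` and `q` lie on a segment across the hyperplane of `e`. -/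
def SegRel (C : CubeComplex X) (e : Cube 1 → X) (p q : X) : Prop :=
  ∃ (k : ℕ) (Ω : Cube (k + 1) → X) (w : Cube k) (s t : Interval), Ω ∈ C.cubes (k + 1) ∧
    C.Dual e Ω 0 ∧ w ∈ openCube k ∧ p = Ω (Matrix.vecCons s w) ∧ q = Ω (Matrix.vecCons t w)

/-- If an interior point of a cube that does not meet the hyperplane and a point of another such cube
lie on a common segment, they are equal or corresponding points of the first cube and its
opposite: both can only be ends of the segment. -/
theorem SegRel.exists_opp {e : Cube 1 → X} {m n : ℕ}
    {Φ : Cube m → X} {Ψ : Cube n → X} (hΦ : Φ ∈ C.cubes m) (hΨ : Ψ ∈ C.cubes n)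
    (hdΦ : ∀ i, ¬ C.Dual e Φ i) (hdΨ : ∀ i, ¬ C.Dual e Ψ i) {x : Cube m} {y : Cube n}
    (hx : x ∈ openCube m) (h : C.SegRel e (Φ x) (Ψ y)) :
    Φ x = Ψ y ∨ ∃ Φ', C.Opp e Φ Φ' ∧ Φ' x = Ψ y := by
  obtain ⟨k, Ω, w, s, t, hΩ, h0, hw, hs, ht⟩ := h
  have hse : IsEnd s := by
    rw [← not_isInner_iff]
    intro hs'
    obtain ⟨j, hj, -⟩ := exists_dual_of_eq hΦ hΩ hs h0 hs'
    exact hdΦ j hj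
  have hte : IsEnd t := by
    rw [← not_isInner_iff]
    intro ht'
    obtain ⟨j, hj, -⟩ := exists_dual_of_eq hΨ hΩ ht h0 ht'
    exact hdΨ j hj
  have key : ∀ {Ω : Cube (k + 1) → X}, Ω ∈ C.cubes (k + 1) → C.Dual e Ω 0 →
      Φ x = leftFacet Ω w → Ψ y = rightFacet Ω w → ∃ Φ', C.Opp e Φ Φ' ∧ Φ' x = Ψ y := by
    intro Ω hΩ h0 h1 h2
    obtain ⟨rfl, g, hg, hgx⟩ := eq_comp_of_meet (leftFacet_mem hΩ) hΦ hw hx h1.symm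
    refine ⟨rightFacet Ω ∘ g.map, ?_, ?_⟩
    · rw [hg]
      exact Opp.comp ⟨Ω, hΩ, h0, rfl, rfl⟩ g
    · rw [h2, Function.comp_apply, hgx]
  rcases hse with rfl | rfl <;> rcases hte with rfl | rfl
  · exact Or.inl (hs.trans ht.symm)
  · exact Or.inr (key hΩ h0 hs ht)
  · refine Or.inr (key (reflect_mem hΩ) ((dual_consMap_iff hΩ _ _).2 h0) ?_ ?_)
    · rw [leftFacet_reflect]; exact hs
    · rw [rightFacet_reflect]; exact ht
  · exact Or.inl (hs.trans ht.symm)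

/-- Two cubes that do not meet the hyperplane and whose corresponding points lie on common segments
are equal or opposite. It suffices to check this at one generic point. -/
theorem eq_or_opp {e : Cube 1 → X} {m : ℕ} {Φ Ψ : Cube m → X} (hΦ : Φ ∈ C.cubes m)
    (hΨ : Ψ ∈ C.cubes m) (hdΦ : ∀ i, ¬ C.Dual e Φ i) (hdΨ : ∀ i, ¬ C.Dual e Ψ i)
    (h : Φ (generic m) = Ψ (generic m) ∨ C.SegRel e (Φ (generic m)) (Ψ (generic m))) :
    Φ = Ψ ∨ C.Opp e Φ Ψ := by
  have key : ∀ {Φ : Cube m → X}, Φ ∈ C.cubes m → Φ (generic m) = Ψ (generic m) → Φ = Ψ := by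
    intro Φ hΦ h
    obtain ⟨-, g, hg, hgx⟩ := eq_comp_of_meet hΦ hΨ (generic_mem m) (generic_mem m) h
    have : g.map = (idMap m).map := map_eq_of_generic hgx
    rw [hg, this]; rfl
  rcases h with h | h
  · exact Or.inl (key hΦ h)
  · rcases h.exists_opp hΦ hΨ hdΦ hdΨ (generic_mem m) with h | ⟨Φ', h, h'⟩
    · exact Or.inl (key hΦ h)
    · exact Or.inr (key h.right_mem h' ▸ h)

/-! ### The product structure on the neighbourhood of a separating hyperplane -/

/-- Every segment across the hyperplane of `e`, oriented as `e` up to the sign `s`, is the segment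
in the first direction of a cube through a point that is interior in the other directions. -/
theorem exists_chart {e : Cube 1 → X} {n : ℕ} {Φ : Cube n → X} (hΦ : Φ ∈ C.cubes n) {i : Fin n}
    {s : Bool} (h : C.Parallel e (CubeCx.revIf s (edge Φ i))) (x : Cube n) :
    ∃ (k : ℕ) (Ω : Cube (k + 1) → X) (w : Cube k), Ω ∈ C.cubes (k + 1) ∧
      C.Parallel e (edge Ω 0) ∧ w ∈ openCube k ∧
      ∀ t, Ω (Matrix.vecCons t w) = Φ (Function.update x i (flip s t)) := by
  obtain ⟨k, a, w, hw, ha, has, hmap⟩ := exists_carrier_segment x i s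
  refine ⟨k, Φ ∘ a.map, w, C.face_mem Φ a hΦ, ?_, hw, fun t => ?_⟩
  · have := edge_comp_parallel hΦ a 0
    rw [ha, has] at this
    exact h.trans this.symm
  · rw [Function.comp_apply, hmap]

namespace SeparatingEdge

variable {e : Cube 1 → X}

/-- Two segments across the hyperplane, both oriented as `e`, that meet are equal. If they meet
inside, this holds as their cubes are equal up to a symmetry, which preserves the dual direction,
as there are no self-intersections, and its orientation, as the hyperplane is two-sided. If they
meet at the end, it holds by the uniqueness of dual edges at a vertex. -/
theorem segment_unique (he : C.SeparatingEdge e) {k l : ℕ} {Ω : Cube (k + 1) → X}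
    {Ω' : Cube (l + 1) → X} (hΩ : Ω ∈ C.cubes (k + 1)) (hΩ' : Ω' ∈ C.cubes (l + 1))
    (hp : C.Parallel e (edge Ω 0)) (hp' : C.Parallel e (edge Ω' 0)) {w : Cube k} {w' : Cube l}
    (hw : w ∈ openCube k) (hw' : w' ∈ openCube l) {s t : Interval}
    (h : Ω (Matrix.vecCons s w) = Ω' (Matrix.vecCons t w')) :
    s = t ∧ ∀ r, Ω (Matrix.vecCons r w) = Ω' (Matrix.vecCons r w') := by
  have h0 : C.Dual e Ω 0 := hp.sameHyperplane
  have h0' : C.Dual e Ω' 0 := hp'.sameHyperplane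
  have inner : IsInner s ↔ IsInner t := by
    constructor
    · intro hs
      obtain ⟨j, hj, hj', -⟩ := exists_dual_of_eq hΩ' hΩ h.symm h0 hs
      rw [he.dual_unique hΩ' hj h0'] at hj'
      exact hj'
    · intro ht
      obtain ⟨j, hj, hj', -⟩ := exists_dual_of_eq hΩ hΩ' h h0' ht
      rw [he.dual_unique hΩ hj h0] at hj'
      exact hj'
  by_cases hs : IsInner s
  · obtain ⟨hkl, g, rfl, hg⟩ := eq_comp_of_meet hΩ hΩ' (vecCons_mem_openCube hs hw)
      (vecCons_mem_openCube (inner.1 hs) hw') h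
    obtain rfl : k = l := by omega
    have hg0 : g.inj 0 = 0 := he.dual_unique hΩ ((dual_comp_iff hΩ g 0).1 h0') h0
    have hsign : g.sign 0 = false := by
      by_contra hne
      have h1 := edge_comp_parallel hΩ g 0
      rw [hg0, Bool.eq_true_of_not_eq_false hne] at h1
      exact he.special.no_one_sided _ (edge_mem hΩ 0) ((hp.symm.trans hp').trans h1)
    have hmap : ∀ r, g.map (Matrix.vecCons r w') = Matrix.vecCons r w := by
      intro r
      rw [← update_vecCons_zero t r w', map_update, hg, hg0, hsign, flip_false,
        update_vecCons_zero]
    refine ⟨?_, fun r => by rw [Function.comp_apply, hmap]⟩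
    rw [hmap t] at hg
    exact (congrFun hg 0).symm
  · have hs' : IsEnd s := not_isInner_iff.1 hs
    have ht' : IsEnd t := not_isInner_iff.1 (fun ht => hs (inner.2 ht))
    have facet_mem : ∀ {m : ℕ} {Θ : Cube (m + 1) → X}, Θ ∈ C.cubes (m + 1) → ∀ {r}, IsEnd r →
        (fun w => Θ (Matrix.vecCons r w)) ∈ C.cubes m := by
      rintro m Θ hΘ r (rfl | rfl)
      · exact leftFacet_mem hΘ
      · exact rightFacet_mem hΘ
    obtain ⟨rfl, g, hg, hgw⟩ := eq_comp_of_meet (facet_mem hΩ hs') (facet_mem hΩ' ht') hw hw' h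
    -- after a symmetry of the other directions, the two cubes have a common facet
    set Θ := Ω ∘ (consMap false g).map with hΘdef
    have hΘ : Θ ∈ C.cubes (k + 1) := C.face_mem Ω _ hΩ
    have hΘ0 : C.Dual e Θ 0 := (dual_consMap_iff hΩ _ _).2 h0
    have hΘapp : ∀ r v, Θ (Matrix.vecCons r v) = Ω (Matrix.vecCons r (g.map v)) := by
      intro r v; rw [hΘdef, Function.comp_apply, consMap_map, flip_false]
    have hΘp : C.Parallel e (edge Θ 0) := by
      have h1 := edge_comp_parallel hΩ (consMap false g) 0
      rw [consMap_inj_zero, show (consMap false g).sign 0 = false from rfl, revIf_false] at h1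
      exact hp.trans h1.symm
    have hfac : ∀ v, Θ (Matrix.vecCons s v) = Ω' (Matrix.vecCons t v) := fun v => by
      rw [hΘapp]; exact (congrFun hg v).symm
    have hpar := hΘp.symm.trans hp'
    have hsides := Parallel.sideRel he.special he.mem hpar hΘ0
    have hend := he.ends h0'
    simp only [edge_zero_apply] at hsides hend
    have hΩΘ : ∀ r, Ω (Matrix.vecCons r w) = Θ (Matrix.vecCons r w') := fun r => by
      rw [hΘapp, hgw]
    suffices s = t ∧ Θ = Ω' by
      refine ⟨this.1, fun r => ?_⟩
      rw [hΩΘ, this.2]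
    have hc := hfac (corner k)
    rcases hs' with rfl | rfl <;> rcases ht' with rfl | rfl
    · exact ⟨rfl, he.eq_of_leftFacet hΘ hΩ' hΘ0 h0' (funext hfac)⟩
    · refine absurd ?_ hend
      rw [← hc]
      exact hsides.1.symm
    · refine absurd ?_ hend
      have := hsides.2
      rw [hc] at this
      exact this
    · refine ⟨rfl, ?_⟩
      have := he.eq_of_leftFacet (reflect_mem hΘ) (reflect_mem hΩ')
        ((dual_consMap_iff hΘ _ _).2 hΘ0) ((dual_consMap_iff hΩ' _ _).2 h0')
        (by rw [leftFacet_reflect, leftFacet_reflect]; exact funext hfac)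
      rw [← reflect_reflect Θ, this, reflect_reflect]

end SeparatingEdge

/-- A cube with a direction that is dual to the hyperplane of `e`. -/
structure DualDir (C : CubeComplex X) (e : Cube 1 → X) where
  dim : ℕ
  cube : Cube dim → X
  mem : cube ∈ C.cubes dim
  dir : Fin dim
  dual : C.Dual e cube dir

namespace DualDir

variable {e : Cube 1 → X}

theorem mid_mem (d : DualDir C e) (x : Cube d.dim) :
    d.cube (Function.update x d.dir mid) ∈ C.hyperplane e :=
  (mem_hyperplane_iff d.mem).2 ⟨d.dir, d.dual, by simp⟩

theorem range_subset (d : DualDir C e) (x : Cube d.dim) :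
    d.cube x ∈ C.unitNbhd (C.hyperplane e) :=
  ⟨d.dim, d.cube, d.mem, (range_meets_iff d.mem).2 ⟨_, d.dual⟩, x, rfl⟩

/-- The map of the disjoint union of the cubes that meet the hyperplane to the midcubes. -/
def toHyperplane (p : Σ d : DualDir C e, Cube d.dim) : C.hyperplane e :=
  ⟨p.1.cube (Function.update p.2 p.1.dir mid), p.1.mid_mem p.2⟩

/-- The map of the disjoint union of the cubes that meet the hyperplane to its neighbourhood. -/
def toNbhd (p : Σ d : DualDir C e, Cube d.dim) : C.unitNbhd (C.hyperplane e) :=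
  ⟨p.1.cube p.2, p.1.range_subset p.2⟩

theorem continuous_toHyperplane : Continuous (toHyperplane (C := C) (e := e)) := by
  refine continuous_sigma fun d => Continuous.subtype_mk ?_ _
  exact (continuous_cube d.mem).comp (continuous_id.update d.dir continuous_const)

theorem continuous_toNbhd : Continuous (toNbhd (C := C) (e := e)) :=
  continuous_sigma fun d => Continuous.subtype_mk (continuous_cube d.mem) _

theorem toHyperplane_surjective : Function.Surjective (toHyperplane (C := C) (e := e)) := by
  rintro ⟨_, n, Φ, i, x, hΦ, hi, hx, rfl⟩
  refine ⟨⟨⟨n, Φ, hΦ, i, hi⟩, x⟩, Subtype.ext ?_⟩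
  simp [toHyperplane, ← hx]

theorem toNbhd_surjective : Function.Surjective (toNbhd (C := C) (e := e)) := by
  rintro ⟨_, n, Φ, hΦ, h, x, rfl⟩
  obtain ⟨i, hi⟩ := (range_meets_iff hΦ).1 h
  exact ⟨⟨⟨n, Φ, hΦ, i, hi⟩, x⟩, rfl⟩

theorem isClosed_of_image {A : Set X} {S : Set A} (h : IsClosed (Subtype.val '' S : Set X)) :
    IsClosed S := by
  rw [← preimage_image_eq S Subtype.val_injective]
  exact h.preimage continuous_subtype_val

theorem isQuotientMap_toHyperplane (he : C.SeparatingEdge e) :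
    IsQuotientMap (toHyperplane (C := C) (e := e)) := by
  refine isQuotientMap_iff_isClosed.2 ⟨toHyperplane_surjective, fun S =>
    ⟨fun h => h.preimage continuous_toHyperplane, fun h => isClosed_of_image ?_⟩⟩
  rw [isClosed_sigma_iff] at h
  rw [C.isClosed_iff]
  intro n Φ hΦ
  by_cases hd : ∃ i, C.Dual e Φ i
  · obtain ⟨i, hi⟩ := hd
    convert (isClosed_eq (continuous_apply i) (continuous_const (y := mid))).inter
      (h ⟨n, Φ, hΦ, i, hi⟩) using 1
    ext x
    constructor
    · rintro ⟨p, hp, hpx⟩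
      have hmem : Φ x ∈ C.hyperplane e := hpx ▸ p.2
      obtain ⟨j, hj, hx⟩ := (mem_hyperplane_iff hΦ).1 hmem
      rw [he.dual_unique hΦ hj hi] at hx
      refine ⟨hx, ?_⟩
      have : toHyperplane ⟨⟨n, Φ, hΦ, i, hi⟩, x⟩ = p :=
        Subtype.ext (by simp [toHyperplane, ← hx, hpx])
      exact (this ▸ hp : toHyperplane ⟨⟨n, Φ, hΦ, i, hi⟩, x⟩ ∈ S)
    · rintro ⟨hx, hS⟩
      refine ⟨_, hS, ?_⟩
      have hx : x i = mid := hx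
      simp [toHyperplane, ← hx]
  · convert isClosed_empty
    rw [eq_empty_iff_forall_notMem]
    rintro x ⟨p, -, hpx⟩
    have hmem : Φ x ∈ C.hyperplane e := hpx ▸ p.2
    obtain ⟨j, hj, -⟩ := (mem_hyperplane_iff hΦ).1 hmem
    exact hd ⟨j, hj⟩

/-- The neighbourhood has the quotient topology from the cubes that meet the hyperplane: it meets
any other cube in a finite union of faces that are faces of such cubes, too. -/
theorem isQuotientMap_toNbhd : IsQuotientMap (toNbhd (C := C) (e := e)) := by
  refine isQuotientMap_iff_isClosed.2 ⟨toNbhd_surjective, fun S =>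
    ⟨fun h => h.preimage continuous_toNbhd, fun h => isClosed_of_image ?_⟩⟩
  rw [isClosed_sigma_iff] at h
  rw [C.isClosed_iff]
  intro n Ψ hΨ
  let J := {q : Σ m : Fin (n + 1), FaceMap m n //
    ∃ (d : DualDir C e) (b : FaceMap q.1 d.dim), Ψ ∘ q.2.map = d.cube ∘ b.map}
  have : ∀ m : Fin (n + 1), Finite (FaceMap m n) := fun m => FaceMap.finite _ _
  have hJ : Finite J := inferInstance
  have hU : Ψ ⁻¹' (Subtype.val '' S) =
      ⋃ q : J, q.1.2.map '' ((Ψ ∘ q.1.2.map) ⁻¹' (Subtype.val '' S)) := by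
    ext x
    simp only [mem_iUnion]
    constructor
    · rintro ⟨p, hp, hpx⟩
      obtain ⟨⟨d, y⟩, rfl⟩ := toNbhd_surjective p
      obtain ⟨k, a, b, z, -, hab, rfl, rfl⟩ := common_face hΨ d.mem hpx.symm
      refine ⟨⟨⟨⟨k, Nat.lt_succ_of_le a.le⟩, a⟩, d, b, hab⟩, z, ?_, rfl⟩
      exact ⟨_, hp, hpx⟩
    · rintro ⟨q, z, hz, rfl⟩
      exact hz
  rw [hU]
  refine isClosed_iUnion_of_finite fun q => ?_
  obtain ⟨d, b, hab⟩ := q.2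
  have hcl : IsClosed ((Ψ ∘ q.1.2.map) ⁻¹' (Subtype.val '' S)) := by
    rw [hab]
    convert (h d).preimage b.continuous_map using 1
    ext z
    constructor
    · rintro ⟨p, hp, hpz⟩
      have : toNbhd ⟨d, b.map z⟩ = p := Subtype.ext hpz.symm
      exact (this ▸ hp : toNbhd ⟨d, b.map z⟩ ∈ S)
    · intro hz
      exact ⟨_, hz, rfl⟩
  exact (hcl.isCompact.image q.1.2.continuous_map).isClosed

end DualDir

open DualDir

namespace SeparatingEdge

variable {e : Cube 1 → X}

/-- The parametrization of the segments across the hyperplane, oriented as `e`. -/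
theorem exists_segments (he : C.SeparatingEdge e) : ∃ c : C.hyperplane e → Interval → X,
    ∀ {n : ℕ} {Φ : Cube n → X}, Φ ∈ C.cubes n → ∀ {i : Fin n} {s : Bool},
      C.Parallel e (CubeCx.revIf s (edge Φ i)) → ∀ (x : Cube n) (p : C.hyperplane e),
        (p : X) = Φ (Function.update x i mid) → ∀ t, c p t = Φ (Function.update x i (flip s t)) := by
  have h : ∀ p : C.hyperplane e, ∃ (k : ℕ) (Ω : Cube (k + 1) → X) (w : Cube k),
      Ω ∈ C.cubes (k + 1) ∧ C.Parallel e (edge Ω 0) ∧ w ∈ openCube k ∧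
      Ω (Matrix.vecCons mid w) = p := by
    rintro ⟨_, n, Φ, i, x, hΦ, hi, hx, rfl⟩
    obtain ⟨s, hs⟩ := sameHyperplane_iff.1 hi
    obtain ⟨k, Ω, w, hΩ, hp, hw, hmap⟩ := exists_chart hΦ hs x
    refine ⟨k, Ω, w, hΩ, hp, hw, ?_⟩
    rw [hmap, flip_mid]
    exact congrArg Φ (Function.update_eq_self_iff.2 hx.symm)
  choose k Ω w hΩ hp hw hmid using h
  refine ⟨fun p t => Ω p (Matrix.vecCons t (w p)), ?_⟩
  intro n Φ hΦ i s hs x p hpx t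
  obtain ⟨k', Ω', w', hΩ', hp', hw', hmap⟩ := exists_chart hΦ hs x
  rw [← hmap]
  refine (he.segment_unique (hΩ p) hΩ' (hp p) hp' (hw p) hw' (s := mid) (t := mid) ?_).2 t
  rw [hmid, hmap, flip_mid, hpx]

theorem exists_productStructure (he : C.SeparatingEdge e) :
    ∃ h : (C.hyperplane e × Interval) ≃ₜ C.unitNbhd (C.hyperplane e),
      C.IsProductStructure (C.hyperplane e) h := by
  obtain ⟨c, hc⟩ := he.exists_segments
  have hsign : ∀ d : DualDir C e, ∃ s, C.Parallel e (CubeCx.revIf s (edge d.cube d.dir)) :=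
    fun d => sameHyperplane_iff.1 d.dual
  choose s hs using hsign
  have hcd : ∀ (d : DualDir C e) (x : Cube d.dim) (t : Interval),
      c (toHyperplane ⟨d, x⟩) t = d.cube (Function.update x d.dir (flip (s d) t)) :=
    fun d x t => hc d.mem (hs d) x _ rfl t
  have hcd' : ∀ (d : DualDir C e) (x : Cube d.dim),
      c (toHyperplane ⟨d, x⟩) (flip (s d) (x d.dir)) = d.cube x := by
    intro d x
    rw [hcd, flip_flip, Function.update_eq_self]
  have hmem : ∀ p t, c p t ∈ C.unitNbhd (C.hyperplane e) := by
    intro p t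
    obtain ⟨⟨d, x⟩, rfl⟩ := toHyperplane_surjective p
    rw [hcd]
    exact d.range_subset _
  let f : C.hyperplane e × Interval → C.unitNbhd (C.hyperplane e) := fun q => ⟨c q.1 q.2, hmem _ _⟩
  have hinj : Function.Injective f := by
    rintro ⟨p, t⟩ ⟨p', t'⟩ hpp
    have hpp : c p t = c p' t' := congrArg Subtype.val hpp
    obtain ⟨⟨d, x⟩, rfl⟩ := toHyperplane_surjective p
    obtain ⟨⟨d', x'⟩, rfl⟩ := toHyperplane_surjective p'
    obtain ⟨k, Ω, w, hΩ, hp, hw, hmap⟩ := exists_chart d.mem (hs d) x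
    obtain ⟨k', Ω', w', hΩ', hp', hw', hmap'⟩ := exists_chart d'.mem (hs d') x'
    rw [hcd, hcd, ← hmap, ← hmap'] at hpp
    obtain ⟨rfl, hall⟩ := he.segment_unique hΩ hΩ' hp hp' hw hw' hpp
    refine Prod.ext (Subtype.ext ?_) rfl
    have := hall mid
    rwa [hmap, hmap', flip_mid, flip_mid] at this
  have hsurj : Function.Surjective f := by
    intro q
    obtain ⟨⟨d, x⟩, rfl⟩ := toNbhd_surjective q
    exact ⟨⟨toHyperplane ⟨d, x⟩, flip (s d) (x d.dir)⟩, Subtype.ext (hcd' d x)⟩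
  have hcont : Continuous f := by
    refine Continuous.subtype_mk ?_ _
    refine (isQuotientMap_toHyperplane he).continuous_lift_prod_left ?_
    rw [← Homeomorph.sigmaProdDistrib.symm.comp_continuous_iff']
    refine continuous_sigma fun d => ?_
    have : Continuous fun q : Cube d.dim × Interval =>
        d.cube (Function.update q.1 d.dir (flip (s d) q.2)) :=
      (continuous_cube d.mem).comp
        (continuous_fst.update d.dir ((continuous_flip _).comp continuous_snd))
    convert this using 1
    ext q
    exact hcd d q.1 q.2
  let E := Equiv.ofBijective f ⟨hinj, hsurj⟩
  have hE : ∀ (d : DualDir C e) (x : Cube d.dim),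
      E.symm (toNbhd ⟨d, x⟩) = (toHyperplane ⟨d, x⟩, flip (s d) (x d.dir)) := by
    intro d x
    rw [Equiv.symm_apply_eq]
    exact Subtype.ext (hcd' d x).symm
  refine ⟨⟨E, hcont, ?_⟩, ?_⟩
  · refine isQuotientMap_toNbhd.continuous_iff.2 (continuous_sigma fun d => ?_)
    have h1 : Continuous fun x : Cube d.dim => toHyperplane (C := C) (e := e) ⟨d, x⟩ :=
      continuous_toHyperplane.comp continuous_sigmaMk
    have h2 : Continuous fun x : Cube d.dim => flip (s d) (x d.dir) :=
      (continuous_flip _).comp (continuous_apply _)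
    convert h1.prodMk h2 using 1
    ext x : 1
    exact hE d x
  · intro n Φ i hΦ hmid
    obtain ⟨j, hj, hji⟩ := (mem_hyperplane_iff hΦ).1
      (hmid (Function.update (corner n) i mid) (by simp))
    have hi : C.Dual e Φ i := by
      by_cases hne : j = i
      · exact hne ▸ hj
      · rw [Function.update_of_ne hne] at hji
        exact absurd hji left_ne_mid
    obtain ⟨r, hr⟩ := sameHyperplane_iff.1 hi
    refine ⟨r, fun x p hp => ?_⟩
    change c p (flip r (x i)) = Φ x
    rw [hc hΦ hr x p hp, flip_flip, Function.update_eq_self]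

end SeparatingEdge

end CubeComplex

/-! ### The collapse as a cube complex -/

theorem exists_face_succAbove {k : ℕ} (i : Fin (k + 1)) : ∃ a : FaceMap k (k + 1),
    a.inj = i.succAbove ∧
      ∀ x : Cube (k + 1), a.map (fun j => x (i.succAbove j)) = Function.update x i left := by
  refine ⟨faceAt i.succAbove Fin.succAbove_right_injective (corner (k + 1)), faceAt_inj _ _ _,
    fun x => faceAt_map _ (fun j => ?_) (fun j hj => ⟨?_, isCorner_corner _ j⟩)⟩
  · rw [Function.update_of_ne (Fin.succAbove_ne i j)]
  · have : j = i := by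
      by_contra h
      obtain ⟨l, hl⟩ := Fin.exists_succAbove_eq h
      exact hj l hl
    rw [this, Function.update_self]; rfl

theorem eq_of_apply_corner {X : Type u} {v w : Cube 0 → X} (h : v (corner 0) = w (corner 0)) :
    v = w := by
  ext x; rw [Subsingleton.elim x (corner 0), h]

namespace CubeComplex

variable {X : Type u} [TopologicalSpace X] {C : CubeComplex X}

/-- The cubes of dimension `n` that do not meet the hyperplane of `e`. -/
def avoiding (C : CubeComplex X) (e : Cube 1 → X) (n : ℕ) : Set (Cube n → X) :=
  {Φ | Φ ∈ C.cubes n ∧ ∀ i, ¬ C.Dual e Φ i}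

theorem avoiding_comp {e : Cube 1 → X} {m n : ℕ} {Φ : Cube n → X} (h : Φ ∈ C.avoiding e n)
    (g : FaceMap m n) : Φ ∘ g.map ∈ C.avoiding e m :=
  ⟨C.face_mem _ _ h.1, fun i hi => h.2 _ ((dual_comp_iff h.1 g i).1 hi)⟩

theorem avoiding_edge {e : Cube 1 → X} {n : ℕ} {Φ : Cube n → X} (h : Φ ∈ C.avoiding e n)
    (i : Fin n) : edge Φ i ∈ C.avoiding e 1 := by
  obtain ⟨g, -, hg⟩ := edge_eq_comp i
  rw [hg]; exact avoiding_comp h g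

theorem avoiding_one_iff {e f : Cube 1 → X} :
    f ∈ C.avoiding e 1 ↔ f ∈ C.cubes 1 ∧ ¬ C.SameHyperplane e f := by
  refine and_congr_right fun _ => ⟨fun h h' => h 0 ((dual_self 0).2 h'), fun h i h' => ?_⟩
  exact h ((dual_self i).1 h')

theorem avoiding_reverse {e f : Cube 1 → X} (h : f ∈ C.avoiding e 1) :
    reverse f ∈ C.avoiding e 1 := by
  convert avoiding_comp h (consMap true (idMap 0)) using 1
  ext t
  simp only [reverse, Function.comp_apply]
  congr 1
  rw [← vecCons_head_tail t, consMap_map]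
  ext i; rw [Subsingleton.elim i 0]; rfl

theorem Opp.mem_avoiding {e : Cube 1 → X} (he : C.SeparatingEdge e) {m : ℕ} {Φ Ψ : Cube m → X}
    (h : C.Opp e Φ Ψ) : Φ ∈ C.avoiding e m ∧ Ψ ∈ C.avoiding e m :=
  ⟨⟨h.left_mem, h.not_dual_left he⟩, ⟨h.right_mem, h.not_dual_right he⟩⟩

theorem segRel_update {e : Cube 1 → X} {n : ℕ} {Φ : Cube n → X} (hΦ : Φ ∈ C.cubes n) {i : Fin n}
    (hi : C.Dual e Φ i) (x : Cube n) (s t : Interval) :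
    C.SegRel e (Φ (Function.update x i s)) (Φ (Function.update x i t)) := by
  obtain ⟨k, a, w, hw, ha, -, hmap⟩ := exists_carrier_segment x i false
  refine ⟨k, Φ ∘ a.map, w, s, t, C.face_mem Φ a hΦ, (dual_comp_iff' hΦ a ha).2 hi, hw, ?_, ?_⟩
  · rw [Function.comp_apply, hmap]; rfl
  · rw [Function.comp_apply, hmap]; rfl

theorem Opp.segRel {e : Cube 1 → X} {m : ℕ} {Φ Ψ : Cube m → X} (h : C.Opp e Φ Ψ) (x : Cube m) :
    C.SegRel e (Φ x) (Ψ x) := by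
  obtain ⟨Ω, hΩ, h0, rfl, rfl⟩ := h
  have := segRel_update hΩ h0 (Matrix.vecCons left x) left right
  rwa [update_vecCons_zero, update_vecCons_zero] at this

/-- The quotient map `π` collapses precisely the segments across the hyperplane of `e`. -/
structure IsCollapseMap (C : CubeComplex X) (e : Cube 1 → X) {Y : Type u} [TopologicalSpace Y]
    (π : X → Y) : Prop where
  isQuotientMap : IsQuotientMap π
  eq_iff : ∀ p q, π p = π q ↔ p = q ∨ C.SegRel e p q

namespace IsCollapseMap

variable {e : Cube 1 → X} {Y : Type u} [TopologicalSpace Y] {π : X → Y}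

theorem comp_eq (hπ : C.IsCollapseMap e π) {m : ℕ} {Φ Ψ : Cube m → X} (h : C.Opp e Φ Ψ) :
    π ∘ Φ = π ∘ Ψ := funext fun x => (hπ.eq_iff _ _).2 (Or.inr (h.segRel x))

theorem eq_or_opp (hπ : C.IsCollapseMap e π) {m : ℕ} {Φ Ψ : Cube m → X} (hΦ : Φ ∈ C.avoiding e m)
    (hΨ : Ψ ∈ C.avoiding e m) (h : π ∘ Φ = π ∘ Ψ) : Φ = Ψ ∨ C.Opp e Φ Ψ :=
  CubeComplex.eq_or_opp hΦ.1 hΨ.1 hΦ.2 hΨ.2 ((hπ.eq_iff _ _).1 (congrFun h _))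

theorem eq_or_exists_opp (hπ : C.IsCollapseMap e π) {m n : ℕ} {Φ : Cube m → X} {Ψ : Cube n → X}
    (hΦ : Φ ∈ C.avoiding e m) (hΨ : Ψ ∈ C.avoiding e n) {x : Cube m} {y : Cube n}
    (hx : x ∈ openCube m) (h : π (Φ x) = π (Ψ y)) :
    Φ x = Ψ y ∨ ∃ Φ', C.Opp e Φ Φ' ∧ Φ' x = Ψ y := by
  rcases (hπ.eq_iff _ _).1 h with h | h
  · exact Or.inl h
  · exact h.exists_opp hΦ.1 hΨ.1 hΦ.2 hΨ.2 hx

/-- A cube that meets the hyperplane has the same image as one of its facets that do not. -/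
theorem exists_avoiding_face (hπ : C.IsCollapseMap e π) (he : C.SeparatingEdge e) {n : ℕ}
    {Φ : Cube n → X} (hΦ : Φ ∈ C.cubes n) : ∃ (k : ℕ) (Φ' : Cube k → X) (σ : Fin k → Fin n),
      Φ' ∈ C.avoiding e k ∧ ∀ x, π (Φ x) = π (Φ' (fun j => x (σ j))) := by
  by_cases h : ∃ i, C.Dual e Φ i
  · obtain ⟨i, hi⟩ := h
    cases n with
    | zero => exact i.elim0
    | succ k =>
      obtain ⟨a, ha, hmap⟩ := exists_face_succAbove i
      refine ⟨k, Φ ∘ a.map, i.succAbove, ⟨C.face_mem _ _ hΦ, fun j hj => ?_⟩, fun x => ?_⟩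
      · have := he.dual_unique hΦ ((dual_comp_iff hΦ a j).1 hj) hi
        rw [ha] at this
        exact Fin.succAbove_ne i j this
      · rw [hπ.eq_iff, Function.comp_apply, hmap]
        have := segRel_update hΦ hi x (x i) left
        rw [Function.update_eq_self] at this
        exact Or.inr this
  · rw [not_exists] at h
    exact ⟨n, Φ, id, ⟨hΦ, h⟩, fun x => rfl⟩

/-- The collapse as a cube complex: its cubes are the images of the cubes that do not meet the
hyperplane. -/
def complex (hπ : C.IsCollapseMap e π) (he : C.SeparatingEdge e) : CubeComplex Y where
  cubes n := {Ψ | ∃ Φ ∈ C.avoiding e n, Ψ = π ∘ Φ}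
  face_mem := by
    rintro m n _ g ⟨Φ, hΦ, rfl⟩
    exact ⟨_, avoiding_comp hΦ g, rfl⟩
  injOn := by
    rintro n _ ⟨Φ, hΦ, rfl⟩ x hx y hy hxy
    rcases hπ.eq_or_exists_opp hΦ hΦ hx hxy with h | ⟨Φ', h, h'⟩
    · exact C.injOn Φ hΦ.1 hx hy h
    · -- a cube cannot be its own opposite, as this one is on the other side of the hyperplane
      obtain ⟨-, g, hg, -⟩ := eq_comp_of_meet hΦ.1 h.right_mem hy hx h'.symm
      refine absurd ?_ (h.not_sideRel he (g.isCorner_map (isCorner_corner n)) (isCorner_corner n))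
      rw [hg]
      exact SideRel.refl _ _
  cover := by
    intro q
    obtain ⟨p, rfl⟩ := hπ.isQuotientMap.surjective q
    obtain ⟨n, Φ, x, hΦ, hx, rfl⟩ := C.cover p
    obtain ⟨k, Φ', σ, hΦ', h⟩ := hπ.exists_avoiding_face he hΦ
    exact ⟨k, _, _, ⟨Φ', hΦ', rfl⟩, fun j => hx (σ j), (h x).symm⟩
  eq_of_meet := by
    rintro m n _ _ x y ⟨Φ, hΦ, rfl⟩ ⟨Ψ, hΨ, rfl⟩ hx hy hxy
    rcases hπ.eq_or_exists_opp hΦ hΨ hx hxy with h | ⟨Φ', h, h'⟩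
    · obtain ⟨rfl, g, rfl⟩ := C.eq_of_meet Φ Ψ x y hΦ.1 hΨ.1 hx hy h
      exact ⟨rfl, g, rfl⟩
    · obtain ⟨rfl, g, rfl⟩ := C.eq_of_meet Φ' Ψ x y h.right_mem hΨ.1 hx hy h'
      refine ⟨rfl, g, ?_⟩
      rw [hπ.comp_eq h]; rfl
  isClosed_iff := by
    intro s
    rw [← hπ.isQuotientMap.isClosed_preimage, C.isClosed_iff]
    constructor
    · rintro h n _ ⟨Φ, hΦ, rfl⟩
      exact h n Φ hΦ.1
    · intro h n Φ hΦ
      obtain ⟨k, Φ', σ, hΦ', hσ⟩ := hπ.exists_avoiding_face he hΦ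
      have h1 : IsClosed ((π ∘ Φ') ⁻¹' s) := h k _ ⟨Φ', hΦ', rfl⟩
      have h2 : Continuous fun (x : Cube n) (j : Fin k) => x (σ j) :=
        continuous_pi fun j => continuous_apply _
      convert h1.preimage h2 using 1
      ext x
      change π (Φ x) ∈ s ↔ π (Φ' _) ∈ s
      rw [hσ]
  finite_dim := by
    obtain ⟨N, hN⟩ := C.finite_dim
    refine ⟨N, fun n hn => ?_⟩
    rw [eq_empty_iff_forall_notMem]
    rintro _ ⟨Φ, hΦ, rfl⟩
    rw [avoiding, mem_ofPred_eq, hN n hn] at hΦ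
    exact hΦ.1

/-! ### The link condition for the collapse -/

theorem vertex_eq_or_opp (hπ : C.IsCollapseMap e π) {m n : ℕ} {Φ : Cube m → X} {Ψ : Cube n → X}
    (hΦ : Φ ∈ C.avoiding e m) (hΨ : Ψ ∈ C.avoiding e n)
    (h : π (Φ (corner m)) = π (Ψ (corner n))) : Φ (corner m) = Ψ (corner n) ∨
      ∃ v w : Cube 0 → X, C.Opp e v w ∧ v (corner 0) = Φ (corner m) ∧
        w (corner 0) = Ψ (corner n) := by
  obtain ⟨g, hg⟩ := corner_eq_map m
  have h0 : corner 0 ∈ openCube 0 := fun i => i.elim0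
  have := hπ.eq_or_exists_opp (avoiding_comp hΦ g) hΨ (x := corner 0) (y := corner n) h0
    (by rw [Function.comp_apply, hg, h])
  rw [Function.comp_apply, hg] at this
  refine this.imp id ?_
  rintro ⟨w, hw, hw'⟩
  exact ⟨_, w, hw, by rw [Function.comp_apply, hg], hw'⟩

/-- Cubes with the same image are equal if their corners are. -/
theorem eq_of_corner (hπ : C.IsCollapseMap e π) (he : C.SeparatingEdge e) {m : ℕ}
    {Φ Ψ : Cube m → X} (hΦ : Φ ∈ C.avoiding e m) (hΨ : Ψ ∈ C.avoiding e m) (h : π ∘ Φ = π ∘ Ψ)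
    (hc : Φ (corner m) = Ψ (corner m)) : Φ = Ψ :=
  (hπ.eq_or_opp hΦ hΨ h).resolve_right fun h' => h'.ne_corner he hc

theorem opp_of_corner_ne (hπ : C.IsCollapseMap e π) {m : ℕ}
    {Φ Ψ : Cube m → X} (hΦ : Φ ∈ C.avoiding e m) (hΨ : Ψ ∈ C.avoiding e m) (h : π ∘ Φ = π ∘ Ψ)
    (hc : Φ (corner m) ≠ Ψ (corner m)) : C.Opp e Φ Ψ :=
  (hπ.eq_or_opp hΦ hΨ h).resolve_left fun h' => hc (by rw [h'])

/-- Two lifts of edges that start at the same vertex span a square if the edges do: move the square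
across the hyperplane, if necessary. -/
theorem spanSquare_of_map (hπ : C.IsCollapseMap e π) (he : C.SeparatingEdge e) {f g : Cube 1 → X}
    (hf : f ∈ C.avoiding e 1) (hg : g ∈ C.avoiding e 1) (hfg : f (corner 1) = g (corner 1))
    (h : (hπ.complex he).SpanSquare (π ∘ f) (π ∘ g)) : C.SpanSquare f g := by
  obtain ⟨_, ⟨Φ, hΦ, rfl⟩, h0, h1⟩ := h
  have h0 : π ∘ edge Φ 0 = π ∘ f := h0
  have h1 : π ∘ edge Φ 1 = π ∘ g := h1
  have hΦ0 := avoiding_edge hΦ 0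
  have hΦ1 := avoiding_edge hΦ 1
  by_cases hc : Φ (corner 2) = f (corner 1)
  · refine ⟨Φ, hΦ.1, hπ.eq_of_corner he hΦ0 hf h0 ?_, hπ.eq_of_corner he hΦ1 hg h1 ?_⟩
    · rw [edge_corner, hc]
    · rw [edge_corner, hc, hfg]
  · have k0 := hπ.opp_of_corner_ne hΦ0 hf h0 (by rw [edge_corner]; exact hc)
    have k1 := hπ.opp_of_corner_ne hΦ1 hg h1 (by rw [edge_corner, ← hfg]; exact hc)
    obtain ⟨v, w, hvw, hv, -⟩ := (hπ.vertex_eq_or_opp hΦ hf (by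
      have := congrFun h0 (corner 1)
      simp only [Function.comp_apply, edge_corner] at this
      exact this)).resolve_left hc
    obtain ⟨Ψ, hΨ, -, hedge⟩ := he.exists_opp hΦ.1 hvw hv (ε := ![f, g]) (by
      intro i; fin_cases i
      · exact k0
      · exact k1)
    exact ⟨Ψ, hΨ.right_mem, hedge 0, hedge 1⟩

theorem spanSquare_map (hπ : C.IsCollapseMap e π) (he : C.SeparatingEdge e) {f g : Cube 1 → X}
    (hf : f ∈ C.avoiding e 1) (hg : g ∈ C.avoiding e 1) (h : C.SpanSquare f g) :
    (hπ.complex he).SpanSquare (π ∘ f) (π ∘ g) := by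
  obtain ⟨Φ, hΦ, rfl, rfl⟩ := h
  refine ⟨_, ⟨Φ, ⟨hΦ, fun i => ?_⟩, rfl⟩, rfl, rfl⟩
  fin_cases i
  · exact (avoiding_one_iff.1 hf).2
  · exact (avoiding_one_iff.1 hg).2

/-- Pairwise adjacent edges at a vertex of the collapse lift to edges that start at a common vertex:
if one of them lifts to one side of the hyperplane only, the squares that it spans with the others
are on this side. -/
theorem exists_common_lift (hπ : C.IsCollapseMap e π) (he : C.SeparatingEdge e) {n : ℕ}
    {v : Cube 0 → X} (hv : v ∈ C.avoiding e 0) {ε : Fin n → Cube 1 → X}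
    (hε : ∀ i, ε i ∈ C.avoiding e 1) (hεv : ∀ i, π (ε i (corner 1)) = π (v (corner 0)))
    (hsq : ∀ i j, i ≠ j → (hπ.complex he).SpanSquare (π ∘ ε i) (π ∘ ε j)) :
    ∃ w ∈ C.avoiding e 0, π (w (corner 0)) = π (v (corner 0)) ∧
      ∀ i, ∃ f ∈ C.avoiding e 1, π ∘ f = π ∘ ε i ∧ f (corner 1) = w (corner 0) := by
  by_cases hall : ∀ i, ∃ f ∈ C.avoiding e 1, π ∘ f = π ∘ ε i ∧ f (corner 1) = v (corner 0)
  · exact ⟨v, hv, rfl, hall⟩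
  · push Not at hall
    obtain ⟨i, hi⟩ := hall
    obtain ⟨g, hg⟩ := corner_eq_map 1
    refine ⟨ε i ∘ g.map, avoiding_comp (hε i) g, by rw [Function.comp_apply, hg, hεv],
      fun j => ?_⟩
    rw [Function.comp_apply, hg]
    by_cases hij : i = j
    · subst hij
      exact ⟨ε i, hε i, rfl, rfl⟩
    · obtain ⟨_, ⟨Φ, hΦ, rfl⟩, h0, h1⟩ := hsq i j hij
      have h0 : π ∘ edge Φ 0 = π ∘ ε i := h0
      refine ⟨edge Φ 1, avoiding_edge hΦ 1, h1, ?_⟩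
      have hne := hi (edge Φ 0) (avoiding_edge hΦ 0) h0
      have hne' := hi (ε i) (hε i) rfl
      rw [edge_corner] at hne ⊢
      have h2 : π (Φ (corner 2)) = π (ε i (corner 1)) := by
        have := congrFun h0 (corner 1)
        simp only [Function.comp_apply, edge_corner] at this
        exact this
      -- both starting vertices are opposite to `v`
      obtain ⟨a, b, hab, ha, hb⟩ := (hπ.vertex_eq_or_opp hv (hε i) (hεv i).symm).resolve_left
        hne'.symm
      obtain ⟨a', b', hab', ha', hb'⟩ := (hπ.vertex_eq_or_opp hv hΦ
        ((hεv i).symm.trans h2.symm)).resolve_left hne.symm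
      have haa : a = a' := eq_of_apply_corner (ha.trans ha'.symm)
      subst haa
      rw [← hb', ← hb, he.opp_unique hab hab']

theorem isNPC (hπ : C.IsCollapseMap e π) (he : C.SeparatingEdge e) : (hπ.complex he).IsNPC where
  distinct_vertices := by
    rintro n _ ⟨Φ, hΦ, rfl⟩ i j hij
    refine he.special.npc.distinct_vertices Φ hΦ.1
      (hπ.eq_of_corner he (avoiding_edge hΦ i) (avoiding_edge hΦ j) hij ?_)
    rw [edge_corner, edge_corner]
  determined := by
    rintro n _ _ ⟨Φ, hΦ, rfl⟩ ⟨Ψ, hΨ, rfl⟩ hc hedge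
    have hedge : ∀ i, π ∘ edge Φ i = π ∘ edge Ψ i := hedge
    by_cases hcc : Φ (corner n) = Ψ (corner n)
    · rw [he.special.npc.determined Φ Ψ hΦ.1 hΨ.1 hcc fun i =>
        hπ.eq_of_corner he (avoiding_edge hΦ i) (avoiding_edge hΨ i) (hedge i)
          (by rw [edge_corner, edge_corner, hcc])]
    · obtain ⟨v, w, hvw, hv, hw⟩ := (hπ.vertex_eq_or_opp hΦ hΨ hc).resolve_left hcc
      obtain ⟨Ψ', hΨ', hc', he'⟩ := he.exists_opp hΦ.1 hvw hv (ε := fun i => edge Ψ i) fun i =>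
        hπ.opp_of_corner_ne (avoiding_edge hΦ i) (avoiding_edge hΨ i) (hedge i)
          (by rw [edge_corner, edge_corner]; exact hcc)
      rw [← he.special.npc.determined Ψ' Ψ hΨ'.right_mem hΨ.1 (hc'.trans hw) he']
      exact hπ.comp_eq hΨ'
  flag := by
    rintro n _ ε ⟨v, hv, rfl⟩ hε hinj hsq
    have hlift : ∀ i, ∃ f ∈ C.avoiding e 1, ε i = π ∘ f := fun i => (hε i).1
    choose f hf hεf using hlift
    obtain rfl : ε = fun i => π ∘ f i := funext hεf
    obtain ⟨w, hw, hwv, hg⟩ := hπ.exists_common_lift he hv hf (fun i => (hε i).2) hsq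
    choose g hg hgf hgw using hg
    obtain ⟨Φ, hΦ, hc, hedge⟩ := he.special.npc.flag w g hw.1 (fun i => ⟨(hg i).1, hgw i⟩)
      (fun i j hij => hinj (by simp only [← hgf, hij]))
      (fun i j hij => hπ.spanSquare_of_map he (hg i) (hg j) ((hgw i).trans (hgw j).symm) (by
        rw [hgf, hgf]; exact hsq i j hij))
    refine ⟨_, ⟨Φ, ⟨hΦ, fun i hi => ?_⟩, rfl⟩, ?_, fun i => ?_⟩
    · rw [Dual, hedge] at hi
      exact (avoiding_one_iff.1 (hg i)).2 hi
    · rw [Function.comp_apply, hc, hwv]; rfl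
    · change π ∘ edge Φ i = π ∘ f i
      rw [hedge, hgf]

/-! ### The hyperplanes of the collapse -/

/-- Parallel edges of the collapse have parallel lifts. -/
theorem parallel_of_map (hπ : C.IsCollapseMap e π) (he : C.SeparatingEdge e) {f g : Cube 1 → X}
    (hf : f ∈ C.avoiding e 1) (hg : g ∈ C.avoiding e 1)
    (h : (hπ.complex he).Parallel (π ∘ f) (π ∘ g)) : C.Parallel f g := by
  have same : ∀ {a b}, a ∈ C.avoiding e 1 → b ∈ C.avoiding e 1 → π ∘ a = π ∘ b →
      C.Parallel a b := by
    intro a b ha hb hab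
    rcases hπ.eq_or_opp ha hb hab with rfl | h
    · exact Parallel.refl _
    · exact h.parallel
  have key : ∀ {a b : Cube 1 → Y}, (hπ.complex he).Parallel a b → a = b ∨
      ∃ f ∈ C.avoiding e 1, ∃ g ∈ C.avoiding e 1, a = π ∘ f ∧ b = π ∘ g ∧ C.Parallel f g := by
    intro a b hab
    induction hab with
    | rel a b h =>
      obtain ⟨_, ⟨Φ, hΦ, rfl⟩, rfl, rfl⟩ := h
      have mem : ∀ {r}, IsEnd r → (fun t : Cube 1 => Φ ![t 0, r]) ∈ C.avoiding e 1 := by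
        intro r hr
        convert avoiding_comp hΦ (faceAt ![0] (fun _ _ _ => Subsingleton.elim _ _) ![left, r])
          using 1
        ext t
        rw [Function.comp_apply]
        congr 1
        refine (faceAt_map _ ?_ ?_).symm
        · intro i; fin_cases i; rfl
        · intro j hj
          fin_cases j
          · exact absurd rfl (hj 0)
          · exact ⟨rfl, hr⟩
      exact Or.inr ⟨_, mem isEnd_left, _, mem isEnd_right, rfl, rfl,
        parallel_of_square hΦ.1 isEnd_left isEnd_right⟩
    | refl a => exact Or.inl rfl
    | symm a b _ ih =>
      rcases ih with rfl | ⟨f, hf, g, hg, h1, h2, h3⟩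
      · exact Or.inl rfl
      · exact Or.inr ⟨g, hg, f, hf, h2, h1, h3.symm⟩
    | trans a b c _ _ ih ih' =>
      rcases ih with rfl | ⟨f, hf, g, hg, h1, h2, h3⟩
      · exact ih'
      · rcases ih' with rfl | ⟨f', hf', g', hg', h1', h2', h3'⟩
        · exact Or.inr ⟨f, hf, g, hg, h1, h2, h3⟩
        · exact Or.inr ⟨f, hf, g', hg', h1, h2',
            h3.trans ((same hg hf' (h2.symm.trans h1')).trans h3')⟩
  rcases key h with h | ⟨f', hf', g', hg', h1, h2, h3⟩
  · exact same hf hg h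
  · exact (same hf hf' h1).trans (h3.trans (same hg hg' h2).symm)

theorem sameHyperplane_of_map (hπ : C.IsCollapseMap e π) (he : C.SeparatingEdge e)
    {f g : Cube 1 → X} (hf : f ∈ C.avoiding e 1) (hg : g ∈ C.avoiding e 1)
    (h : (hπ.complex he).SameHyperplane (π ∘ f) (π ∘ g)) : C.SameHyperplane f g :=
  h.imp (hπ.parallel_of_map he hf hg) (hπ.parallel_of_map he hf (avoiding_reverse hg))

theorem cross_of_map (hπ : C.IsCollapseMap e π) (he : C.SeparatingEdge e) {f g : Cube 1 → X}
    (hf : f ∈ C.avoiding e 1) (hg : g ∈ C.avoiding e 1)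
    (h : (hπ.complex he).Cross (π ∘ f) (π ∘ g)) : C.Cross f g := by
  obtain ⟨_, ⟨Φ, hΦ, rfl⟩, h0, h1⟩ := h
  exact ⟨Φ, hΦ.1, hπ.sameHyperplane_of_map he hf (avoiding_edge hΦ 0) h0,
    hπ.sameHyperplane_of_map he hg (avoiding_edge hΦ 1) h1⟩

end IsCollapseMap

theorem Cross.symm {f g : Cube 1 → X} (h : C.Cross f g) : C.Cross g f := by
  obtain ⟨Φ, hΦ, h0, h1⟩ := h
  obtain ⟨Ψ, hΨ, h0', h1'⟩ := spanSquare_edges hΦ (i := 1) (j := 0) (by simp)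
  exact ⟨Ψ, hΨ, h0' ▸ h1, h1' ▸ h0⟩

/-- Edges dual to a hyperplane that does not cross the hyperplane of `e` are on the same side. -/
theorem Parallel.sideRel_of_not_cross {e a b : Cube 1 → X} (h : C.Parallel a b)
    (hcr : ¬ C.Cross a e) : C.SideRel e (a (corner 1)) (b (corner 1)) := by
  induction h with
  | rel a b h =>
    obtain ⟨Φ, hΦ, rfl, rfl⟩ := h
    have h0 : C.SameHyperplane (fun t => Φ ![t 0, left]) (edge Φ 0) := by
      refine Parallel.sameHyperplane ?_
      convert Parallel.refl (C := C) (edge Φ 0) using 1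
      ext t
      simp only [edge]
      congr 1
      ext j; fin_cases j <;> rfl
    refine sideRel_corners hΦ ?_ ?_ ?_
    · intro j; fin_cases j
      · exact isEnd_left
      · exact isEnd_left
    · intro j; fin_cases j
      · exact isEnd_left
      · exact isEnd_right
    · intro j; fin_cases j
      · simp [corner]
      · intro _ h1
        exact hcr ⟨Φ, hΦ, h0, h1⟩
  | refl a => exact SideRel.refl _ _
  | symm a b h ih =>
    refine (ih fun h' => hcr ?_).symm
    obtain ⟨Φ, hΦ, h0, h1⟩ := h'
    exact ⟨Φ, hΦ, (Parallel.sameHyperplane (Parallel.symm h)).trans h0, h1⟩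
  | trans a b c h h' ih ih' =>
    refine (ih hcr).trans (ih' fun hb => hcr ?_)
    obtain ⟨Φ, hΦ, h0, h1⟩ := hb
    exact ⟨Φ, hΦ, (Parallel.sameHyperplane h).trans h0, h1⟩

theorem SameHyperplane.sideRel_of_not_cross {e a b : Cube 1 → X} (h : C.SameHyperplane a b)
    (hcr : ¬ C.Cross a e) (hb : b ∈ C.avoiding e 1) :
    C.SideRel e (a (corner 1)) (b (corner 1)) := by
  rcases h with h | h
  · exact h.sideRel_of_not_cross hcr
  · refine (h.sideRel_of_not_cross hcr).trans ?_
    have : reverse b (corner 1) = b fun _ => right := by simp [reverse, corner]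
    rw [this]
    exact sideRel_corners hb.1 (fun _ => isEnd_right) (isCorner_corner 1) fun j _ => hb.2 j

/-- An edge whose hyperplane crosses the hyperplane of `e` can be moved from one end of an edge dual
to the latter to the other end, as the two hyperplanes do not interosculate. -/
theorem SeparatingEdge.exists_opp_of_cross {e : Cube 1 → X} (he : C.SeparatingEdge e)
    {a : Cube 1 → X} (ha : a ∈ C.avoiding e 1) (hcr : C.Cross a e) {v w : Cube 0 → X}
    (hvw : C.Opp e v w) (hv : v (corner 0) = a (corner 1)) :
    ∃ a', C.Opp e a a' ∧ a' (corner 1) = w (corner 0) := by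
  obtain ⟨k, hk, hk0, rfl, rfl⟩ := hvw
  have hek : C.SameHyperplane e k := (dual_self 0).1 hk0
  have hea := (avoiding_one_iff.1 ha).2
  obtain ⟨Φ, hΦ, h0, h1⟩ := hcr.symm
  have hsq : C.SpanSquare k a := by
    by_contra hsq
    refine he.special.no_interosculation k hk a ha.1 (fun h => hea (hek.trans h))
      ⟨Φ, hΦ, hek.symm.trans h0, h1⟩ ⟨fun h => hea (h ▸ hek), ?_, hsq⟩
    rw [← hv, leftFacet_corner]
  obtain ⟨Θ, hΘ, hΘ0, hΘ1⟩ := hsq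
  refine ⟨rightFacet Θ, ⟨Θ, hΘ, by rw [Dual, hΘ0]; exact hek, ?_, rfl⟩, ?_⟩
  · rw [← hΘ1, show (1 : Fin 2) = Fin.succ 0 from rfl, edge_succ, edge_self]
  · have := congrFun hΘ0 (fun _ => right)
    rw [edge_zero_apply] at this
    simp only [rightFacet]
    rw [this]
    congr 1
    ext i; rw [Subsingleton.elim i 0]; rfl

namespace IsCollapseMap

variable {e : Cube 1 → X} {Y : Type u} [TopologicalSpace Y] {π : X → Y}

theorem osculateAt_of_map (hπ : C.IsCollapseMap e π) (he : C.SeparatingEdge e) {f g : Cube 1 → X}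
    (hf : f ∈ C.avoiding e 1) (hg : g ∈ C.avoiding e 1) (hfg : f (corner 1) = g (corner 1))
    (h : (hπ.complex he).OsculateAt (π ∘ f) (π ∘ g)) : C.OsculateAt f g :=
  ⟨fun h' => h.1 (by rw [h']), hfg, fun h' => h.2.2 (hπ.spanSquare_map he hf hg h')⟩

theorem isSpecial (hπ : C.IsCollapseMap e π) (he : C.SeparatingEdge e) :
    (hπ.complex he).IsSpecial where
  npc := hπ.isNPC he
  no_one_sided := by
    rintro _ ⟨f, hf, rfl⟩ h
    exact he.special.no_one_sided f hf.1 (hπ.parallel_of_map he hf (avoiding_reverse hf) h)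
  no_self_intersection := by
    rintro _ ⟨f, hf, rfl⟩ h
    exact he.special.no_self_intersection f hf.1 (hπ.cross_of_map he hf hf h)
  no_direct_self_osculation := by
    rintro _ ⟨f, hf, rfl⟩ _ ⟨g, hg, rfl⟩ hpar hosc
    have hpar' := hπ.parallel_of_map he hf hg hpar
    rcases hπ.vertex_eq_or_opp hf hg hosc.2.1 with hc | ⟨v, w, hvw, hv, hw⟩
    · exact he.special.no_direct_self_osculation f hf.1 g hg.1 hpar'
        (hπ.osculateAt_of_map he hf hg hc hosc)
    · by_cases hcr : C.Cross f e
      · obtain ⟨f', hff', hf'⟩ := he.exists_opp_of_cross hf hcr hvw hv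
        rw [hπ.comp_eq hff'] at hosc
        exact he.special.no_direct_self_osculation f' hff'.right_mem g hg.1
          (hff'.parallel.symm.trans hpar')
          (hπ.osculateAt_of_map he (hff'.mem_avoiding he).2 hg (hf'.trans hw) hosc)
      · refine hvw.not_sideRel he (isCorner_corner 0) (isCorner_corner 0) ?_
        rw [hv, hw]
        exact hpar'.sideRel_of_not_cross hcr
  no_interosculation := by
    rintro _ ⟨f, hf, rfl⟩ _ ⟨g, hg, rfl⟩ - hcross hosc
    -- lifts with a common start osculate and are dual to crossing hyperplanes, which are distinct,
    -- as a hyperplane does not cross itself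
    have main : ∀ {f' g'}, f' ∈ C.avoiding e 1 → g' ∈ C.avoiding e 1 → C.Parallel f' f →
        C.Parallel g' g → f' (corner 1) = g' (corner 1) →
        ¬ (hπ.complex he).OsculateAt (π ∘ f') (π ∘ g') := by
      intro f' g' hf' hg' hpf hpg hc hosc'
      obtain ⟨Φ, hΦ, h0, h1⟩ := hπ.cross_of_map he hf hg hcross
      have h0' := hpf.sameHyperplane.trans h0
      have h1' := hpg.sameHyperplane.trans h1
      exact he.special.no_interosculation f' hf'.1 g' hg'.1
        (fun h => he.special.no_self_intersection f' hf'.1 ⟨Φ, hΦ, h0', h.trans h1'⟩)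
        ⟨Φ, hΦ, h0', h1'⟩ (hπ.osculateAt_of_map he hf' hg' hc hosc')
    rcases hπ.vertex_eq_or_opp hf hg hosc.2.1 with hc | ⟨v, w, hvw, hv, hw⟩
    · exact main hf hg (Parallel.refl _) (Parallel.refl _) hc hosc
    by_cases hcf : C.Cross f e
    · obtain ⟨f', hff', hf'⟩ := he.exists_opp_of_cross hf hcf hvw hv
      rw [hπ.comp_eq hff'] at hosc
      exact main (hff'.mem_avoiding he).2 hg hff'.parallel.symm (Parallel.refl _)
        (hf'.trans hw) hosc
    by_cases hcg : C.Cross g e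
    · obtain ⟨g', hgg', hg'⟩ := he.exists_opp_of_cross hg hcg hvw.symm hw
      rw [hπ.comp_eq hgg'] at hosc
      exact main hf (hgg'.mem_avoiding he).2 (Parallel.refl _) hgg'.parallel.symm
        (hv.symm.trans hg'.symm) hosc
    -- otherwise the two hyperplanes lie on different sides, and cannot cross
    obtain ⟨_, ⟨Φ, hΦ, rfl⟩, h0, h1⟩ := hcross
    have h0' := hπ.sameHyperplane_of_map he hf (avoiding_edge hΦ 0) h0
    have h1' := hπ.sameHyperplane_of_map he hg (avoiding_edge hΦ 1) h1
    have s0 := h0'.sideRel_of_not_cross hcf (avoiding_edge hΦ 0)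
    have s1 := h1'.sideRel_of_not_cross hcg (avoiding_edge hΦ 1)
    rw [edge_corner] at s0 s1
    refine hvw.not_sideRel he (isCorner_corner 0) (isCorner_corner 0) ?_
    rw [hv, hw]
    exact s0.trans s1.symm

end IsCollapseMap

/-! ### The quotient by a product structure -/

theorem IsProductStructure.collapseRel_iff {e : Cube 1 → X}
    {h : (C.hyperplane e × Interval) ≃ₜ C.unitNbhd (C.hyperplane e)}
    (hh : C.IsProductStructure (C.hyperplane e) h) {p q : X} :
    C.collapseRel h p q ↔ C.SegRel e p q := by
  have key : ∀ {n : ℕ} {Φ : Cube n → X} {i : Fin n}, Φ ∈ C.cubes n → C.Dual e Φ i →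
      ∃ r : Bool, ∀ (x : Cube n) (p : C.hyperplane e), (p : X) = Φ (Function.update x i mid) →
        ∀ t, (h (p, flip r t) : X) = Φ (Function.update x i t) := by
    intro n Φ i hΦ hi
    obtain ⟨r, hr⟩ := hh n Φ i hΦ fun x hx => (mem_hyperplane_iff hΦ).2 ⟨i, hi, hx⟩
    refine ⟨r, fun x p hp t => ?_⟩
    have := hr (Function.update x i t) p (by rw [Function.update_idem]; exact hp)
    rwa [Function.update_self] at this
  constructor
  · rintro ⟨p, s, t, rfl, rfl⟩
    obtain ⟨n, Φ, i, x, hΦ, hi, hx, hp⟩ := p.2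
    obtain ⟨r, hr⟩ := key hΦ hi
    have hval : ∀ t, (h (p, t) : X) = Φ (Function.update x i (flip r t)) := fun t => by
      rw [← hr x p (by rw [← hx, Function.update_eq_self, hp]), flip_flip]
    rw [hval, hval]
    exact segRel_update hΦ hi _ _ _
  · rintro ⟨k, Ω, w, s, t, hΩ, h0, -, rfl, rfl⟩
    obtain ⟨r, hr⟩ := key hΩ h0
    have hp : Ω (Matrix.vecCons mid w) ∈ C.hyperplane e :=
      (mem_hyperplane_iff hΩ).2 ⟨0, h0, rfl⟩
    have hval : ∀ t, (h (⟨_, hp⟩, flip r t) : X) = Ω (Matrix.vecCons t w) := fun t => by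
      rw [hr (Matrix.vecCons mid w) ⟨_, hp⟩ (by rw [update_vecCons_zero]), update_vecCons_zero]
    exact ⟨⟨_, hp⟩, flip r s, flip r t, (hval s).symm, (hval t).symm⟩

theorem IsProductStructure.isCollapseMap {e : Cube 1 → X}
    {h : (C.hyperplane e × Interval) ≃ₜ C.unitNbhd (C.hyperplane e)}
    (hh : C.IsProductStructure (C.hyperplane e) h) :
    C.IsCollapseMap e (Quot.mk (C.collapseRel h)) where
  isQuotientMap := isQuotientMap_quot_mk
  eq_iff p q := by
    rw [Quot.eq, ← hh.collapseRel_iff]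
    constructor
    · intro hpq
      induction hpq with
      | rel a b h => exact Or.inr h
      | refl a => exact Or.inl rfl
      | symm a b _ ih =>
        rcases ih with rfl | ⟨p, s, t, h1, h2⟩
        · exact Or.inl rfl
        · exact Or.inr ⟨p, t, s, h2, h1⟩
      | trans a b c _ _ ih ih' =>
        rcases ih with rfl | ⟨p, s, t, h1, h2⟩
        · exact ih'
        · rcases ih' with rfl | ⟨p', s', t', h1', h2'⟩
          · exact Or.inr ⟨p, s, t, h1, h2⟩
          · have := h.injective (Subtype.ext (h2.symm.trans h1'))
            rw [Prod.mk.injEq] at this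
            exact Or.inr ⟨p, s, t', h1, by rw [this.1]; exact h2'⟩
    · rintro (rfl | h)
      · exact Relation.EqvGen.refl _
      · exact Relation.EqvGen.rel _ _ h

end CubeComplex

end CubeCx

theorem mainTheorem7 {X : Type*} [TopologicalSpace X] [ConnectedSpace X]
    (C : CubeCx.CubeComplex X) (hC : C.IsSpecial)
    (H : Set X) (hH : C.IsHyperplane H) (hsep : CubeCx.CubeComplex.IsSeparating H) :
    (∃ h : (H × CubeCx.Interval) ≃ₜ C.unitNbhd H, C.IsProductStructure H h) ∧
    ∀ h : (H × CubeCx.Interval) ≃ₜ C.unitNbhd H, C.IsProductStructure H h →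
      ∃ D : CubeCx.CubeComplex (C.Collapse h),
        (∀ n, D.cubes n = C.collapseCubes h n) ∧ D.IsNPC ∧ D.IsSpecial := by
  obtain ⟨e, hemem, rfl⟩ := hH
  have he : C.SeparatingEdge e := ⟨hC, hemem, fun hf => hC.not_sideRel hemem hsep hf⟩
  refine ⟨he.exists_productStructure, fun h hh => ?_⟩
  refine ⟨hh.isCollapseMap.complex he, fun n => ?_, hh.isCollapseMap.isNPC he,
    hh.isCollapseMap.isSpecial he⟩
  ext Ψ
  constructor
  · rintro ⟨Φ, hΦ, rfl⟩
    exact ⟨Φ, hΦ.1, (CubeCx.CubeComplex.disjoint_iff hΦ.1).2 hΦ.2, rfl⟩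
  · rintro ⟨Φ, hΦ, hd, rfl⟩
    exact ⟨Φ, ⟨hΦ, (CubeCx.CubeComplex.disjoint_iff hΦ).1 hd⟩, rfl⟩
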